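/- Identify $\mathbb S^1$ with $\mathbb R/2\pi\mathbb Z$, let $\rho(d\theta)=(2\pi)^{-1}d\theta$ and $u_k(\theta)=e^{ik\theta}$, $k\in\mathbb Z$. Fix an integer $s\ge 1$, a real $B>1$ and put $w_s(x)=x^s e^{-x}$. For $\eta\in(0,1)$ and every integer $j\ge 1$ let $\{E_{jq}\}_{q=1}^{Q_j}$ be a partition of $\mathbb S^1$ into measurable sets, with points $x_{jq}\in E_{jq}$ and $\lambda_{jq}=\rho(E_{jq})$, such that $c_1\eta B^{-j}\le\lambda_{jq}\le c_2\eta B^{-j}$ and $c_1\eta^{-1}B^{j}\le Q_j\le c_2\eta^{-1}B^{j}$ with constants $c_1,c_2>0$. The Mexican needlets are the (real-valued) functions $$\psi_{jq;s}(\theta)=\sqrt{\lambda_{jq}}\sum_{k\in\mathbb Z}w_s\big((B^{-j}k)^2\big)\,\overline{u_k(x_{jq})}\,u_k(\theta).$$ Let $\nu(d\theta)=F(\theta)\rho(d\theta)$ be a probability measure on $\mathbb S^1$ with $0<M_0\le F\le M_\infty<\infty$. Let $\tau$ be a measure on $[0,\infty)$ with $\tau(\{0\})=0$ such that $R_t:=\tau([0,t])$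 is finite, strictly increasing in $t$ and tends to $\infty$ as $t\to\infty$. On a probability space let $N$ be a Poisson random measure on $[0,\infty)\times\mathbb S^1$ with control measure $\tau\otimes\nu$, put $N_t(A)=N([0,t]\times A)$, a Poisson random measure on $\mathbb S^1$ with control $R_t\nu$, and let $X_1,X_2,\dots$ be i.i.d. with law $\nu$, with $(X_i)_{i\ge1}$ independent of $N_t(\mathbb S^1)$ for each $t$. Put $b_{jq;s}=\mathbb E[\psi_{jq;s}(X_1)]$, $\sigma_{jq;s}=\big(\mathbb E[\psi_{jq;s}(X_1)^2]\big)^{1/2}$ and, for $t>0$, $$\widetilde\beta^{(R_t)}_{jq;s}=\frac{\sum_{i=1}^{N_t(\mathbb S^1)}\psi_{jq;s}(X_i)-R_t\,b_{jq;s}}{\sqrt{R_t}\,\sigma_{jq;s}}.$$ Let $d_W(X,Y)=\sup_{g}|\mathbb E[g(X)]-\mathbb E[g(Y)]|$, the supremum being over all $g:\mathbb R\to\mathbb R$ with Lipschitz constant at most $1$, be the Wasserstein distance between the laws of two integrable random variables, and let $Z\sim\mathcal N(0,1)$. Theorem. There is a constant $C_0>0$, depending only on $s,B,c_1,c_2,M_0,M_\infty$,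 such that $\widetilde\beta^{(R_t)}_{jq;s}$ is integrable and $$d_W\big(\widetilde\beta^{(R_t)}_{jq;s},Z\big)\le C_0\,(B^{-j}R_t)^{-1/2}$$ for all $j\ge1$, $1\le q\le Q_j$ and $t>0$. Furthermore, if $j=j_t\ge 1$ and $q=q_t\in\{1,\dots,Q_{j_t}\}$ depend on $t$ in such a way that $(B^{-j_t}R_t)^{-1/2}\to0$ as $t\to\infty$, or equivalently $B^{j_t}=o(R_t)$, then $\widetilde\beta^{(R_t)}_{j_tq_t;s}$ converges in distribution to $Z$ as $t\to\infty$. The same statements, with the same $C_0$, hold for the coefficient evaluated on the points of the Poisson field itself, that is, with $\widetilde\beta^{(R_t)}_{jq;s}$ replaced by $$\int_{\mathbb S^1} h\,dN_t-R_t\int_{\mathbb S^1}h\,d\nu,\qquad h=\frac{\psi_{jq;s}}{\sqrt{R_t}\,\sigma_{jq;s}}.$$ -/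

import Mathlib

open MeasureTheory ProbabilityTheory Filter Topology
open scoped NNReal ENNReal

noncomputable section

namespace CircularNeedlet

instance two_pi_pos_fact : Fact (0 < 2 * Real.pi) := ⟨Real.two_pi_pos⟩

/-- The unit circle, parametrised by the angle: `ℝ / 2πℤ` with its Borel sets. -/
abbrev S1 : Type := AddCircle (2 * Real.pi)

/-- The uniform probability measure `ρ(dθ) = (2π)⁻¹ dθ` on the circle. -/
def rho : Measure S1 := AddCircle.haarAddCircle

/-! ### Mexican needlets -/

/-- The weight function `w_s(x) = x ^ s * exp (-x)`. -/
def weight (s : ℕ) (x : ℝ) : ℝ := x ^ s * Real.exp (-x)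

/-- The pixels of a Mexican needlet system with scale parameter `B` and pixel parameter `η`:
for every positive resolution level `j`, a partition of the circle into `Q j` measurable
sets `E j q` with points `x j q ∈ E j q`, such that, up to the constants `c₁` and `c₂`,
the length of `E j q` is of order `η B⁻ʲ` and `Q j` is of order `η⁻¹ Bʲ`. -/
structure Pixelization (B η c₁ c₂ : ℝ) where
  Q : ℕ → ℕ
  E : (j : ℕ) → Fin (Q j) → Set S1
  x : (j : ℕ) → Fin (Q j) → S1
  measurableSet_E : ∀ j, 1 ≤ j → ∀ q, MeasurableSet (E j q)
  disjoint_E : ∀ j, 1 ≤ j → ∀ q q', q ≠ q' → Disjoint (E j q) (E j q')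
  cover_E : ∀ j, 1 ≤ j → (⋃ q, E j q) = Set.univ
  mem_E : ∀ j, 1 ≤ j → ∀ q, x j q ∈ E j q
  length_lower : ∀ j, 1 ≤ j → ∀ q, c₁ * (η * (B ^ j)⁻¹) ≤ rho.real (E j q)
  length_upper : ∀ j, 1 ≤ j → ∀ q, rho.real (E j q) ≤ c₂ * (η * (B ^ j)⁻¹)
  card_lower : ∀ j, 1 ≤ j → c₁ * (η⁻¹ * B ^ j) ≤ Q j
  card_upper : ∀ j, 1 ≤ j → (Q j : ℝ) ≤ c₂ * (η⁻¹ * B ^ j)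

/-- The circular Mexican needlet
`ψ_{jq;s}(θ) = √λ_{jq} ∑_{k ∈ ℤ} w_s((B⁻ʲ k)²) conj(u_k(x_{jq})) u_k(θ)`,
with `λ_{jq} = ρ(E_{jq})` and `u_k(θ) = exp(i k θ)`. -/
def needletC {B η c₁ c₂ : ℝ} (D : Pixelization B η c₁ c₂) (s j : ℕ) (q : Fin (D.Q j))
    (θ : S1) : ℂ :=
  (Real.sqrt (rho.real (D.E j q)) : ℂ) *
    ∑' k : ℤ, (weight s (((B ^ j)⁻¹ * (k : ℝ)) ^ 2) : ℂ) *
      (starRingEnd ℂ) (fourier k (D.x j q)) * fourier k θ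

/-- The Mexican needlet as a real function; nothing is lost, see `ofReal_needlet`. -/
def needlet {B η c₁ c₂ : ℝ} (D : Pixelization B η c₁ c₂) (s j : ℕ) (q : Fin (D.Q j))
    (θ : S1) : ℝ :=
  (needletC D s j q θ).re

/-- The functions `fourier k` on `ℝ / 2πℤ` are the functions `u_k(θ) = exp(i k θ)`. -/
theorem fourier_eq_exp (k : ℤ) (θ : ℝ) :
    fourier k (θ : S1) = Complex.exp (Complex.I * k * θ) := by
  rw [fourier_coe_apply]
  congr 1
  have h : (Real.pi : ℂ) ≠ 0 := by exact_mod_cast Real.pi_ne_zero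
  push_cast
  field_simp

/-- The Mexican needlets are real valued. -/
theorem ofReal_needlet {B η c₁ c₂ : ℝ} (D : Pixelization B η c₁ c₂) (s j : ℕ)
    (q : Fin (D.Q j)) (θ : S1) : (needlet D s j q θ : ℂ) = needletC D s j q θ := by
  refine Complex.conj_eq_iff_re.mp ?_
  unfold needletC
  rw [map_mul, Complex.conj_ofReal, Complex.conj_tsum]
  congr 1
  rw [← (Equiv.neg ℤ).tsum_eq]
  refine tsum_congr fun k => ?_
  simp only [Equiv.neg_apply, map_mul, Complex.conj_ofReal, fourier_neg, Complex.conj_conj,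
    Int.cast_neg, mul_neg, neg_sq]

/-! ### Poisson random measures and needlet coefficients -/

/-- `N` is a Poisson random measure with control `μ`, defined on the probability
space `(Ω, P)`. -/
structure IsPoissonRandomMeasure {Ω Θ : Type*} [MeasurableSpace Ω] [MeasurableSpace Θ]
    (P : Measure Ω) (μ : Measure Θ) (N : Ω → Measure Θ) : Prop where
  measurable_apply : ∀ A, MeasurableSet A → Measurable fun ω => N ω A
  integer_valued : ∀ ω A, MeasurableSet A → ∃ n : ℕ∞, N ω A = (n : ℝ≥0∞)
  law_of_ne_top : ∀ A, MeasurableSet A → μ A ≠ ∞ →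
    P.map (fun ω => N ω A) = (poissonMeasure (μ A).toNNReal).map fun n : ℕ => (n : ℝ≥0∞)
  law_of_eq_top : ∀ A, MeasurableSet A → μ A = ∞ → ∀ᵐ ω ∂P, N ω A = ∞
  independent : ∀ (n : ℕ) (A : Fin n → Set Θ), (∀ i, MeasurableSet (A i)) →
    Pairwise (Function.onFun Disjoint A) → iIndepFun (fun i ω => N ω (A i)) P

/-- The intensity `R_t = τ([0,t])`. -/
def intensity (τ : Measure ℝ≥0) (t : ℝ≥0) : ℝ := τ.real (Set.Icc 0 t)

/-- The conditions on the time component `τ` of the control measure: `R_t` is finite,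
strictly increasing and divergent, and `τ({0}) = 0`. -/
structure IsTimeControl (τ : Measure ℝ≥0) : Prop where
  finite : ∀ t, τ (Set.Icc 0 t) ≠ ∞
  zero : τ {0} = 0
  strictMono : StrictMono (intensity τ)
  tendsto : Tendsto (intensity τ) atTop atTop

/-- The law `ν(dθ) = F(θ) ρ(dθ)` on the circle. -/
def densityLaw (F : S1 → ℝ) : Measure S1 := rho.withDensity fun θ => ENNReal.ofReal (F θ)

/-- The circular Poisson field `N_t(A) = N([0,t] × A)`. -/
def circularField {Ω : Type*} (N : Ω → Measure (ℝ≥0 × S1)) (t : ℝ≥0) (ω : Ω) : Measure S1 :=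
  ((N ω).restrict (Set.Icc 0 t ×ˢ Set.univ)).map Prod.snd

/-- The number of points `N_t(S¹)`, as a natural number. -/
def count {Ω : Type*} (N : Ω → Measure (ℝ≥0 × S1)) (t : ℝ≥0) (ω : Ω) : ℕ :=
  ⌊(circularField N t ω Set.univ).toReal⌋₊

/-- The Wiener-Itô integral `Ñ(h) = ∫ h dN - ∫ h dμ` of `h` with respect to the compensated
measure `N - μ`. -/
def compensatedIntegral {Θ : Type*} [MeasurableSpace Θ] (N μ : Measure Θ) (h : Θ → ℝ) : ℝ :=
  ∫ θ, h θ ∂N - ∫ θ, h θ ∂μ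

/-- `b = E[f(X)]` for `X` with law `ν`. -/
def mean (ν : Measure S1) (f : S1 → ℝ) : ℝ := ∫ θ, f θ ∂ν

/-- `σ`, the nonnegative square root of `σ² = E[f(X)²]`, for `X` with law `ν`. -/
def sigma (ν : Measure S1) (f : S1 → ℝ) : ℝ := Real.sqrt (∫ θ, f θ ^ 2 ∂ν)

/-- The normalized coefficient `Ñ_t(f / (√R_t σ))` of `f` on the Poisson field `N_t`, where
`N_t` has control `μ_t = R_t ν`. -/
def fieldCoeff {Ω : Type*} (N : Ω → Measure (ℝ≥0 × S1)) (τ : Measure ℝ≥0) (ν : Measure S1)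
    (f : S1 → ℝ) (t : ℝ≥0) (ω : Ω) : ℝ :=
  compensatedIntegral (circularField N t ω) (ENNReal.ofReal (intensity τ t) • ν)
    fun θ => f θ / (Real.sqrt (intensity τ t) * sigma ν f)

/-- The normalized coefficient
`(∑_{i ≤ N_t(S¹)} f(X_i) - R_t b) / (√R_t σ)`; the sequence `X` is indexed from `0`. -/
def sampleCoeff {Ω : Type*} (N : Ω → Measure (ℝ≥0 × S1)) (X : ℕ → Ω → S1) (τ : Measure ℝ≥0)
    (ν : Measure S1) (f : S1 → ℝ) (t : ℝ≥0) (ω : Ω) : ℝ :=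
  (∑ i ∈ Finset.range (count N t ω), f (X i ω) - intensity τ t * mean ν f) /
    (Real.sqrt (intensity τ t) * sigma ν f)

/-- The Wasserstein distance between two laws on `ℝ`, as an extended nonnegative number:
the supremum of `|E[g(X)] - E[g(Y)]|` over the functions `g` with Lipschitz constant at
most `1`. -/
def wassersteinDist (P₁ P₂ : Measure ℝ) : ℝ≥0∞ :=
  ⨆ (g : ℝ → ℝ) (_ : LipschitzWith 1 g), ENNReal.ofReal |∫ x, g x ∂P₁ - ∫ x, g x ∂P₂|

/-- The standard Gaussian law `N(0,1)`. -/
abbrev stdGaussian : Measure ℝ := gaussianReal 0 1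

end CircularNeedlet

end

/-! Let ψ be a needlet and h = ψ / (√R_t σ). The sum over the sample and the integral against the
field have the same law `coeffLaw`: compound Poisson with rate R_t and jump law the image m of ν
under h, shifted to mean zero. For the sum this follows by conditioning on the number of terms
(`map_sum_range_count`), for the field by comparing characteristic functions
(`IsPoissonRandomMeasure.map_integral`). Only one law has to be estimated.

Its variance is R_t ∫ h² dν = 1. Insert the solution f of Stein's equation f'(w) - w f(w) = g(w) - E
g(Z) (`exists_stein_solution`) into the Mecke formula E[S φ(S)] = r E ∫ y φ(S + y) m(dy)
(`CompoundPoisson.integral_id_mul`). Mean and variance cancel the zeroth and first order terms in y,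
and what is left of E g(S - E S) - E g(Z) is a second order Taylor remainder of f integrated against
r y m(dy). Since f' is 6-Lipschitz, this is at most 6 r ∫ |y|³ dm ≤ 6 sup |h|
(`CompoundPoisson.wassersteinDist_le`).

It remains to bound sup |ψ| / σ. Summing the weights gives sup |ψ| ≲ √λ Bʲ, while Parseval and F ≥
M₀ give σ ≳ √(M₀ λ Bʲ). The pixel length λ cancels, leaving a multiple of √(Bʲ)
(`sigma_pos_and_abs_needlet_le`), so sup |h| ≲ (B⁻ʲ R_t)^(-1/2). Convergence in distribution follows
by testing against Lipschitz functions. -/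

/-! ### Stein's equation for the standard Gaussian law -/

namespace SteinEquation

/-- The moments of the (unnormalised) Gaussian tail `exp (-(w * u) - u ^ 2 / 2)`, `u > 0`. -/
noncomputable def tailMoment (n : ℕ) (w : ℝ) : ℝ :=
  ∫ u in Set.Ioi (0 : ℝ), u ^ n * Real.exp (-(w * u) - u ^ 2 / 2)

theorem integrable_pow_mul_exp_neg_sq (n : ℕ) :
    Integrable fun x : ℝ => x ^ n * Real.exp (-(x ^ 2 / 2)) := by
  have h := integrable_rpow_mul_exp_neg_mul_sq (b := 1 / 2) (by norm_num) (s := n)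
    (by have : (0 : ℝ) ≤ n := n.cast_nonneg
        linarith)
  simp only [Real.rpow_natCast] at h
  refine h.congr (ae_of_all _ fun x => ?_)
  simp only
  congr 2
  ring

theorem integrableOn_tail (n : ℕ) {w : ℝ} (hw : 0 ≤ w) :
    IntegrableOn (fun u : ℝ => u ^ n * Real.exp (-(w * u) - u ^ 2 / 2)) (Set.Ioi 0) := by
  refine (integrable_pow_mul_exp_neg_sq n).integrableOn.mono'
    (by fun_prop) ?_
  filter_upwards [ae_restrict_mem measurableSet_Ioi] with u hu
  have hu : 0 < u := hu
  rw [Real.norm_of_nonneg (by positivity)]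
  gcongr
  nlinarith [mul_nonneg hw hu.le]

theorem tailMoment_nonneg (n : ℕ) (w : ℝ) : 0 ≤ tailMoment n w :=
  setIntegral_nonneg measurableSet_Ioi fun u hu => by
    have hu : 0 < u := hu
    positivity

theorem hasDerivAt_tail (w u : ℝ) : HasDerivAt (fun u : ℝ => Real.exp (-(w * u) - u ^ 2 / 2))
    (-(w + u) * Real.exp (-(w * u) - u ^ 2 / 2)) u := by
  have h : HasDerivAt (fun u : ℝ => -(w * u) - u ^ 2 / 2) (-(w + u)) u := by
    have := (((hasDerivAt_id u).const_mul w).neg).sub ((hasDerivAt_pow 2 u).div_const 2)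
    exact this.congr_deriv (by simp; ring)
  exact h.exp.congr_deriv (by ring)

/-- Integrate the derivative of the Gaussian tail over the half line; the `1` is its value at `u =
0`. -/
theorem tailMoment_one {w : ℝ} (hw : 0 ≤ w) : tailMoment 1 w = 1 - w * tailMoment 0 w := by
  have i0 := integrableOn_tail 0 hw
  have i1 := integrableOn_tail 1 hw
  have hd : ∀ u ∈ Set.Ioi (0 : ℝ), HasDerivAt (fun u : ℝ => u ^ 0 * Real.exp (-(w * u) - u ^ 2 / 2))
      (-(w * (u ^ 0 * Real.exp (-(w * u) - u ^ 2 / 2))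
        + u ^ 1 * Real.exp (-(w * u) - u ^ 2 / 2))) u := fun u _ => by
    convert hasDerivAt_tail w u using 1
    · ext; simp
    · ring
  have hi := ((i0.const_mul w).add i1).neg
  have hlim := tendsto_zero_of_hasDerivAt_of_integrableOn_Ioi hd hi i0
  have := integral_Ioi_of_hasDerivAt_of_tendsto (by fun_prop) hd hi hlim
  rw [integral_neg, integral_add (i0.const_mul w) i1, integral_const_mul] at this
  simp only [tailMoment]
  simp at this ⊢
  linarith

/-- The same integration by parts with a factor `u ^ (n + 1)`, which kills the boundary term. -/
theorem tailMoment_add_two (n : ℕ) {w : ℝ} (hw : 0 ≤ w) :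
    tailMoment (n + 2) w = (n + 1) * tailMoment n w - w * tailMoment (n + 1) w := by
  have i0 := integrableOn_tail n hw
  have i1 := integrableOn_tail (n + 1) hw
  have i2 := integrableOn_tail (n + 2) hw
  have hd : ∀ u ∈ Set.Ioi (0 : ℝ),
      HasDerivAt (fun u : ℝ => u ^ (n + 1) * Real.exp (-(w * u) - u ^ 2 / 2))
      ((n + 1) * (u ^ n * Real.exp (-(w * u) - u ^ 2 / 2))
        - (w * (u ^ (n + 1) * Real.exp (-(w * u) - u ^ 2 / 2))
        + u ^ (n + 2) * Real.exp (-(w * u) - u ^ 2 / 2))) u := fun u _ => by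
    refine ((hasDerivAt_pow (n + 1) u).mul (hasDerivAt_tail w u)).congr_deriv ?_
    push_cast
    ring
  have hi := (i0.const_mul (n + 1 : ℝ)).sub ((i1.const_mul w).add i2)
  have hlim := tendsto_zero_of_hasDerivAt_of_integrableOn_Ioi hd hi i1
  have := integral_Ioi_of_hasDerivAt_of_tendsto (by fun_prop) hd hi hlim
  rw [integral_sub (i0.const_mul (n + 1 : ℝ)) (by exact (i1.const_mul w).add i2),
    integral_add (i1.const_mul w) i2, integral_const_mul, integral_const_mul] at this
  simp only [tailMoment]
  simp at this ⊢
  linarith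

theorem tailMoment_zero_le {w : ℝ} (hw : 0 ≤ w) : tailMoment 0 w ≤ 2 := by
  have h : tailMoment 0 w ≤ ∫ u in Set.Ioi (0 : ℝ), Real.exp (-(1 / 2) * u ^ 2) := by
    refine setIntegral_mono_on (integrableOn_tail 0 hw) ?_ measurableSet_Ioi fun u hu => ?_
    · exact (integrable_exp_neg_mul_sq (by norm_num)).integrableOn
    · have hu : 0 < u := hu
      simp only [pow_zero, one_mul]
      gcongr
      nlinarith [mul_nonneg hw hu.le]
  rw [integral_gaussian_Ioi] at h
  have h4 : √(Real.pi / (1 / 2)) ≤ 4 := by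
    rw [Real.sqrt_le_left (by norm_num)]
    linarith [Real.pi_lt_four]
  linarith

variable {G : ℝ → ℝ}

/-- Minus the solution of Stein's equation on the right half line. -/
noncomputable def tailAverage (G : ℝ → ℝ) (w : ℝ) : ℝ :=
  ∫ u in Set.Ioi (0 : ℝ), G (w + u) * Real.exp (-(w * u) - u ^ 2 / 2)

/-- Freezing `G` at `w` costs at most `u` at distance `u`, hence one first moment in total. -/
theorem abs_tailAverage_sub_le (hG : LipschitzWith 1 G) {w : ℝ} (hw : 0 ≤ w) :
    |tailAverage G w - G w * tailMoment 0 w| ≤ tailMoment 1 w := by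
  have hc : Continuous G := hG.continuous
  have hb (u : ℝ) (hu : 0 < u) : |G (w + u) - G w| ≤ u := by
    have := hG.dist_le_mul (w + u) w
    simpa [Real.dist_eq, abs_of_pos hu] using this
  have i0 := integrableOn_tail 0 hw
  have i1 := integrableOn_tail 1 hw
  have hle : ∀ᵐ u ∂(volume.restrict (Set.Ioi (0 : ℝ))),
      ‖(G (w + u) - G w) * Real.exp (-(w * u) - u ^ 2 / 2)‖
        ≤ u ^ 1 * Real.exp (-(w * u) - u ^ 2 / 2) := by
    filter_upwards [ae_restrict_mem measurableSet_Ioi] with u hu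
    rw [norm_mul, Real.norm_eq_abs, Real.norm_of_nonneg (Real.exp_pos _).le, pow_one]
    gcongr
    exact hb u hu
  have id : IntegrableOn (fun u => (G (w + u) - G w) * Real.exp (-(w * u) - u ^ 2 / 2))
      (Set.Ioi 0) := i1.mono' (by fun_prop) hle
  have : tailAverage G w - G w * tailMoment 0 w
      = ∫ u in Set.Ioi (0 : ℝ), (G (w + u) - G w) * Real.exp (-(w * u) - u ^ 2 / 2) := by
    rw [tailAverage, tailMoment, ← integral_const_mul, sub_eq_iff_eq_add,
      ← integral_add id (i0.const_mul _)]
    congr 1 with u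
    ring
  rw [this]
  exact norm_integral_le_of_norm_le i1 hle

theorem abs_le_one_add (hG : LipschitzWith 1 G) (h0 : |G 0| ≤ 1) {w : ℝ} (hw : 0 ≤ w) :
    |G w| ≤ 1 + w := by
  have := hG.dist_le_mul w 0
  simp only [Real.dist_eq, NNReal.coe_one, one_mul, sub_zero, abs_of_nonneg hw] at this
  calc |G w| = |G 0 + (G w - G 0)| := by ring_nf
    _ ≤ |G 0| + |G w - G 0| := abs_add_le _ _
    _ ≤ _ := by gcongr

/-- With `m i` for the tail moments, the bound is `m 1 + (1 + w) * m 0 = 1 + m 0`: the linear growth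
of `G` is absorbed by `tailMoment_one`. -/
theorem abs_tailAverage_le (hG : LipschitzWith 1 G) (h0 : |G 0| ≤ 1) {w : ℝ} (hw : 0 ≤ w) :
    |tailAverage G w| ≤ 4 := by
  have h1 := abs_tailAverage_sub_le hG hw
  have h2 := tailMoment_one hw
  have h3 := tailMoment_zero_le hw
  have h4 := tailMoment_nonneg 1 w
  have h5 := tailMoment_nonneg 0 w
  have h6 : |G w * tailMoment 0 w| ≤ (1 + w) * tailMoment 0 w := by
    rw [abs_mul, abs_of_nonneg h5]
    gcongr
    exact abs_le_one_add hG h0 hw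
  rw [abs_le] at *
  constructor <;> linarith

/-- After freezing `G` at `w`, its coefficient `(1 + w ^ 2) * m 0 - w` collapses to `m 2`, so
nothing grows with `w`. Nonnegativity of `m 2` gives `(1 + w ^ 2) * m 1 ≤ 1`, and that of `m 3`
gives `w * m 2 ≤ 2 * m 1`; the constant is `5 = 1 + 2 + 2`. -/
theorem abs_deriv_tailAverage_le (hG : LipschitzWith 1 G) (h0 : |G 0| ≤ 1) {w : ℝ} (hw : 0 ≤ w) :
    |(1 + w ^ 2) * tailAverage G w - w * G w| ≤ 5 := by
  have h1 := abs_tailAverage_sub_le hG hw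
  have h2 := tailMoment_one hw
  have h3 := tailMoment_zero_le hw
  have h4 := tailMoment_nonneg 1 w
  have h5 := tailMoment_nonneg 0 w
  have h7 := tailMoment_add_two 0 hw
  have h8 := tailMoment_add_two 1 hw
  have h9 := tailMoment_nonneg 2 w
  have h10 := tailMoment_nonneg 3 w
  norm_num at h7 h8
  have h11 : tailMoment 1 w ≤ 1 := by nlinarith
  have h12 : (1 + w ^ 2) * tailMoment 1 w ≤ 1 := by nlinarith
  have h13 : tailMoment 2 w ≤ 2 := by nlinarith
  have h14 : |G w * tailMoment 2 w| ≤ (1 + w) * tailMoment 2 w := by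
    rw [abs_mul, abs_of_nonneg h9]
    gcongr
    exact abs_le_one_add hG h0 hw
  have h15 : |(1 + w ^ 2) * (tailAverage G w - G w * tailMoment 0 w)| ≤ 1 := by
    rw [abs_mul, abs_of_nonneg (by positivity)]
    exact (mul_le_mul_of_nonneg_left h1 (by positivity)).trans h12
  have h16 : (1 + w ^ 2) * tailAverage G w - w * G w
      = (1 + w ^ 2) * (tailAverage G w - G w * tailMoment 0 w) + G w * tailMoment 2 w := by
    rw [h7, h2]
    ring
  rw [h16]
  refine (abs_add_le _ _).trans ?_
  linarith

/-- The bounded solution of Stein's equation `f' w = w * f w + G w`. -/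
noncomputable def solution (G : ℝ → ℝ) (w : ℝ) : ℝ :=
  Real.exp (w ^ 2 / 2) * ∫ x in Set.Iic w, G x * Real.exp (-(x ^ 2 / 2))

/-- Substitute `x = w + u` and expand the square. -/
theorem exp_mul_integral_Ioi (G : ℝ → ℝ) (w : ℝ) :
    Real.exp (w ^ 2 / 2) * ∫ x in Set.Ioi w, G x * Real.exp (-(x ^ 2 / 2)) = tailAverage G w := by
  have h := (measurePreserving_add_left volume w).setIntegral_preimage_emb
    (measurableEmbedding_addLeft w) (fun x => G x * Real.exp (-(x ^ 2 / 2))) (Set.Ioi w)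
  rw [← h, ← integral_const_mul, tailAverage]
  have : (w + ·) ⁻¹' Set.Ioi w = Set.Ioi 0 := by
    ext; simp
  rw [this]
  congr 1 with u
  rw [mul_left_comm, ← Real.exp_add]
  congr 2
  ring

theorem integrable_mul_exp (hG : LipschitzWith 1 G) :
    Integrable fun x => G x * Real.exp (-(x ^ 2 / 2)) := by
  have hc := hG.continuous
  have h0 := (integrable_pow_mul_exp_neg_sq 0).const_mul |G 0|
  have h1 := (integrable_pow_mul_exp_neg_sq 1).norm
  refine (h0.add h1).mono' (by fun_prop) (ae_of_all _ fun x => ?_)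
  have := hG.dist_le_mul x 0
  simp only [Real.dist_eq, NNReal.coe_one, one_mul, sub_zero] at this
  simp only [norm_mul, Real.norm_eq_abs, pow_zero, one_mul, pow_one, Pi.add_apply, Real.abs_exp]
  rw [← add_mul]
  gcongr
  calc |G x| = |G 0 + (G x - G 0)| := by ring_nf
    _ ≤ |G 0| + |G x - G 0| := abs_add_le _ _
    _ ≤ _ := by gcongr

/-- Centring makes the left and right integrals opposite. The identity holds for every `w`, but the
right tail is under control only for `0 ≤ w`; negative `w` is handled by reflection. -/
theorem solution_of_nonneg (hG : LipschitzWith 1 G)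
    (hm : ∫ x, G x * Real.exp (-(x ^ 2 / 2)) = 0) (w : ℝ) : solution G w = -tailAverage G w := by
  have h := intervalIntegral.integral_Iic_add_Ioi (b := w) (integrable_mul_exp hG).integrableOn
    (integrable_mul_exp hG).integrableOn
  rw [hm] at h
  rw [solution, eq_neg_of_add_eq_zero_left h, mul_neg, exp_mul_integral_Ioi]

theorem solution_eq_reflect (G : ℝ → ℝ) (w : ℝ) :
    solution G w = tailAverage (fun x => G (-x)) (-w) := by
  rw [solution, ← exp_mul_integral_Ioi, neg_sq]
  have := integral_comp_neg_Ioi (-w) fun x => G x * Real.exp (-(x ^ 2 / 2))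
  rw [neg_neg] at this
  rw [← this]
  simp

theorem lipschitz_reflect (hG : LipschitzWith 1 G) : LipschitzWith 1 fun x => G (-x) := by
  refine LipschitzWith.of_dist_le_mul fun x y => ?_
  simpa using hG.dist_le_mul (-x) (-y)

theorem abs_solution_le (hG : LipschitzWith 1 G) (h0 : |G 0| ≤ 1)
    (hm : ∫ x, G x * Real.exp (-(x ^ 2 / 2)) = 0) (w : ℝ) : |solution G w| ≤ 4 := by
  rcases le_total 0 w with hw | hw
  · rw [solution_of_nonneg hG hm, abs_neg]
    exact abs_tailAverage_le hG h0 hw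
  · rw [solution_eq_reflect]
    exact abs_tailAverage_le (lipschitz_reflect hG) (by simpa using h0) (by linarith)

theorem abs_deriv_solution_le (hG : LipschitzWith 1 G) (h0 : |G 0| ≤ 1)
    (hm : ∫ x, G x * Real.exp (-(x ^ 2 / 2)) = 0) (w : ℝ) :
    |(1 + w ^ 2) * solution G w + w * G w| ≤ 5 := by
  rcases le_total 0 w with hw | hw
  · rw [solution_of_nonneg hG hm]
    convert abs_deriv_tailAverage_le hG h0 hw using 1
    rw [← abs_neg]
    congr 1
    ring
  · rw [solution_eq_reflect]
    convert abs_deriv_tailAverage_le (lipschitz_reflect hG) (by simpa using h0)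
      (w := -w) (by linarith) using 2
    rw [neg_neg]
    ring

theorem hasDerivAt_solution (hG : LipschitzWith 1 G) (w : ℝ) :
    HasDerivAt (solution G) (w * solution G w + G w) w := by
  have hi := integrable_mul_exp hG
  have hc : Continuous fun x => G x * Real.exp (-(x ^ 2 / 2)) := by
    have := hG.continuous
    fun_prop
  have h1 : HasDerivAt (fun w => ∫ x in Set.Iic w, G x * Real.exp (-(x ^ 2 / 2)))
      (G w * Real.exp (-(w ^ 2 / 2))) w := by
    have h2 : (fun w => ∫ x in Set.Iic w, G x * Real.exp (-(x ^ 2 / 2))) = fun w =>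
        (∫ x in Set.Iic 0, G x * Real.exp (-(x ^ 2 / 2)))
          + ∫ x in (0 : ℝ)..w, G x * Real.exp (-(x ^ 2 / 2)) := by
      ext w
      rw [← intervalIntegral.integral_Iic_sub_Iic hi.integrableOn hi.integrableOn]
      ring
    rw [h2]
    exact (intervalIntegral.integral_hasDerivAt_right (hc.intervalIntegrable _ _)
      (hc.stronglyMeasurableAtFilter _ _) hc.continuousAt).const_add _
  have h3 : HasDerivAt (fun w : ℝ => Real.exp (w ^ 2 / 2)) (w * Real.exp (w ^ 2 / 2)) w := by
    have := ((hasDerivAt_pow 2 w).div_const 2).exp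
    exact this.congr_deriv (by simp; ring)
  refine (h3.mul h1).congr_deriv ?_
  have h4 : Real.exp (w ^ 2 / 2) * Real.exp (-(w ^ 2 / 2)) = 1 := by
    rw [← Real.exp_add]
    simp
  simp only [solution]
  linear_combination (G w) * h4

/-- By Stein's equation the derivative of `w * f w` is `(1 + w ^ 2) * f w + w * G w`, bounded by
`5`. As `f' w = w * f w + G w`, this is what makes `f'` Lipschitz. -/
theorem lipschitz_mul_solution (hG : LipschitzWith 1 G) (h0 : |G 0| ≤ 1)
    (hm : ∫ x, G x * Real.exp (-(x ^ 2 / 2)) = 0) :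
    LipschitzWith 5 fun w => w * solution G w := by
  have hd (w : ℝ) : HasDerivAt (fun w => w * solution G w)
      ((1 + w ^ 2) * solution G w + w * G w) w := by
    refine ((hasDerivAt_id w).mul (hasDerivAt_solution hG w)).congr_deriv ?_
    simp only [id]
    ring
  refine lipschitzWith_of_nnnorm_deriv_le (fun w => (hd w).differentiableAt) fun w => ?_
  rw [(hd w).deriv, ← NNReal.coe_le_coe]
  exact abs_deriv_solution_le hG h0 hm w

/-- The derivative of the solution of Stein's equation is Lipschitz, hence a second order Taylor
estimate. -/
theorem abs_taylor_solution_le (hG : LipschitzWith 1 G) (h0 : |G 0| ≤ 1)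
    (hm : ∫ x, G x * Real.exp (-(x ^ 2 / 2)) = 0) (w y : ℝ) :
    |solution G (w + y) - solution G w - y * (w * solution G w + G w)| ≤ 6 * y ^ 2 := by
  set L := w * solution G w + G w
  have hd (x : ℝ) : HasDerivAt (fun x => solution G x - L * x)
      (x * solution G x + G x - L) x := by
    exact ((hasDerivAt_solution hG x).sub ((hasDerivAt_id x).const_mul L)).congr_deriv (by simp)
  -- `L` is the slope at `w`. With the tangent subtracted, the derivative is at most `(5 + 1) * |y|`
  -- between `w` and `w + y`, and the mean value inequality gives the other factor `|y|`.
  have hb : ∀ x ∈ Set.uIcc w (w + y), ‖x * solution G x + G x - L‖ ≤ 6 * |y| := by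
    intro x hx
    have hx : |x - w| ≤ |y| := by
      have := Set.abs_sub_left_of_mem_uIcc hx
      simpa using this
    have h1 := (lipschitz_mul_solution hG h0 hm).dist_le_mul x w
    have h2 := hG.dist_le_mul x w
    simp only [Real.dist_eq, NNReal.coe_one, one_mul, NNReal.coe_ofNat] at h1 h2
    rw [Real.norm_eq_abs]
    calc |x * solution G x + G x - L|
        = |(x * solution G x - w * solution G w) + (G x - G w)| := by
          simp only [L]
          ring_nf
      _ ≤ _ := abs_add_le _ _
      _ ≤ 5 * |x - w| + |x - w| := add_le_add h1 h2
      _ ≤ _ := by linarith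
  have := Convex.norm_image_sub_le_of_norm_hasDerivWithin_le
    (fun x _ => (hd x).hasDerivWithinAt) hb (convex_uIcc w (w + y))
    Set.left_mem_uIcc Set.right_mem_uIcc
  rw [Real.norm_eq_abs, Real.norm_eq_abs, add_sub_cancel_left, mul_assoc, abs_mul_abs_self,
    ← sq] at this
  convert this using 2
  ring

theorem continuous_solution (hG : LipschitzWith 1 G) : Continuous (solution G) :=
  continuous_iff_continuousAt.2 fun w => (hasDerivAt_solution hG w).continuousAt

end SteinEquation

/-! ### Lipschitz functions under the Gaussian law and the Stein solution -/

theorem LipschitzWith.integrable_of_integrable_id {g : ℝ → ℝ} {K : ℝ≥0} (hg : LipschitzWith K g)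
    {μ : Measure ℝ} [IsFiniteMeasure μ] (hμ : Integrable (fun x : ℝ => x) μ) : Integrable g μ := by
  refine ((hμ.norm.const_mul K).add (integrable_const |g 0|)).mono'
    hg.continuous.aestronglyMeasurable (ae_of_all _ fun x => ?_)
  have := hg.dist_le_mul x 0
  simp only [Real.dist_eq, sub_zero] at this
  simp only [Real.norm_eq_abs, Pi.add_apply]
  calc |g x| = |(g x - g 0) + g 0| := by ring_nf
    _ ≤ |g x - g 0| + |g 0| := abs_add_le _ _
    _ ≤ _ := by gcongr

theorem integrable_id_gaussianReal : Integrable (fun x : ℝ => x) (gaussianReal 0 1) := by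
  have := (memLp_id_gaussianReal (μ := 0) (v := 1) 1).integrable (by norm_num)
  exact this

theorem integral_abs_gaussianReal_le : ∫ x, |x| ∂(gaussianReal 0 1) ≤ 1 := by
  have h2 : Integrable (fun x : ℝ => x ^ 2) (gaussianReal 0 1) :=
    (memLp_id_gaussianReal (μ := 0) (v := 1) 2).integrable_sq
  have hv : ∫ x, x ^ 2 ∂(gaussianReal 0 1) = 1 := by
    have := variance_fun_id_gaussianReal (μ := 0) (v := 1)
    rw [variance_eq_integral (by fun_prop)] at this
    simpa using this
  have : ∫ x, |x| ∂(gaussianReal 0 1) ≤ ∫ x, (1 + x ^ 2) / 2 ∂(gaussianReal 0 1) := by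
    refine integral_mono integrable_id_gaussianReal.abs
      (((integrable_const 1).add h2).div_const 2) fun x => ?_
    simp only
    nlinarith [sq_nonneg (|x| - 1), sq_abs x]
  rw [integral_div, integral_add (integrable_const 1) h2, hv] at this
  simpa using this

/-- **Stein's equation**: for every Lipschitz test function there is a bounded `f` with
derivative `f'` such that `f' w - w * f w` is the centred test function and `f'` is Lipschitz. -/
theorem exists_stein_solution {g : ℝ → ℝ} (hg : LipschitzWith 1 g) :
    ∃ f : ℝ → ℝ, Continuous f ∧ (∀ w, |f w| ≤ 4) ∧
      ∀ w y, |f (w + y) - f w - y * (w * f w + (g w - ∫ x, g x ∂(gaussianReal 0 1)))|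
        ≤ 6 * y ^ 2 := by
  set c := ∫ x, g x ∂(gaussianReal 0 1) with hcdef
  have hG : LipschitzWith 1 fun w => g w - c := by
    simpa using hg.sub (LipschitzWith.const c)
  have hgi := hg.integrable_of_integrable_id integrable_id_gaussianReal
  -- The centred function is at most `E|Z| ≤ 1` at the origin, the normalisation required by the
  -- bounds on the solution.
  have h0 : |g 0 - c| ≤ 1 := by
    have : g 0 - c = ∫ x, (g 0 - g x) ∂(gaussianReal 0 1) := by
      rw [integral_sub (integrable_const _) hgi]
      simp [c]
    rw [this]
    have hb : ∀ᵐ x ∂(gaussianReal 0 1), ‖g 0 - g x‖ ≤ |x| := ae_of_all _ fun x => by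
      simpa [Real.dist_eq] using hg.dist_le_mul 0 x
    exact (norm_integral_le_of_norm_le integrable_id_gaussianReal.abs hb).trans
      integral_abs_gaussianReal_le
  have hm : ∫ x, (g x - c) * Real.exp (-(x ^ 2 / 2)) = 0 := by
    have h1 : ∫ x, (g x - c) ∂(gaussianReal 0 1) = 0 := by
      rw [integral_sub hgi (integrable_const _)]
      simp [c]
    rw [integral_gaussianReal_eq_integral_smul (E := ℝ) one_ne_zero] at h1
    have h2 : ∀ x : ℝ, gaussianPDFReal 0 1 x • (g x - c)
        = (√(2 * Real.pi))⁻¹ * ((g x - c) * Real.exp (-(x ^ 2 / 2))) := by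
      intro x
      simp only [gaussianPDFReal, smul_eq_mul, NNReal.coe_one, mul_one, sub_zero, neg_div]
      ring
    simp_rw [h2] at h1
    rw [integral_const_mul] at h1
    have h3 : (√(2 * Real.pi))⁻¹ ≠ 0 := by positivity
    exact (mul_eq_zero.1 h1).resolve_left h3
  exact ⟨SteinEquation.solution fun w => g w - c, SteinEquation.continuous_solution hG,
    SteinEquation.abs_solution_le hG h0 hm, SteinEquation.abs_taylor_solution_le hG h0 hm⟩

/-! ### Compound Poisson laws -/

namespace CompoundPoisson

/-- The `n`-fold convolution power of a law on the line. -/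
noncomputable def convPow (m : Measure ℝ) : ℕ → Measure ℝ
  | 0 => Measure.dirac 0
  | n + 1 => convPow m n ∗ m

/-- The weight of `n` under the Poisson law with parameter `r`. -/
noncomputable def poissonWeight (r : ℝ≥0) (n : ℕ) : ℝ := Real.exp (-r) * r ^ n / n.factorial

/-- The law of the sum of a Poisson number of independent variables with law `m`. -/
noncomputable def compoundPoisson (r : ℝ≥0) (m : Measure ℝ) : Measure ℝ :=
  Measure.sum fun n => ENNReal.ofReal (poissonWeight r n) • convPow m n

theorem poissonWeight_nonneg (r : ℝ≥0) (n : ℕ) : 0 ≤ poissonWeight r n := by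
  unfold poissonWeight
  positivity

theorem hasSum_poissonWeight (r : ℝ≥0) : HasSum (poissonWeight r) 1 :=
  hasSum_one_poissonMeasure r

/-- The size-biasing identity of the Poisson law; it turns the exchangeability of the summands into
the Mecke formula. -/
theorem poissonWeight_succ (r : ℝ≥0) (n : ℕ) :
    poissonWeight r (n + 1) * (n + 1) = r * poissonWeight r n := by
  unfold poissonWeight
  rw [Nat.factorial_succ]
  push_cast
  field_simp
  ring

theorem summable_poissonWeight_mul (r : ℝ≥0) : Summable fun n => poissonWeight r n * n := by
  rw [← summable_nat_add_iff 1]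
  refine ((hasSum_poissonWeight r).summable.mul_left (r : ℝ)).congr fun n => ?_
  push_cast
  exact (poissonWeight_succ r n).symm

instance isProbabilityMeasure_convPow (m : Measure ℝ) [IsProbabilityMeasure m] (n : ℕ) :
    IsProbabilityMeasure (convPow m n) := by
  induction n with
  | zero => exact Measure.dirac.isProbabilityMeasure
  | succ n ih =>
    rw [convPow]
    infer_instance

theorem hasSum_integral {m : Measure ℝ} {r : ℝ≥0} {E : Type*} [NormedAddCommGroup E] [NormedSpace ℝ E] [CompleteSpace E]
    {F : ℝ → E} (hF : Integrable F (compoundPoisson r m)) :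
    HasSum (fun n => poissonWeight r n • ∫ s, F s ∂(convPow m n))
      (∫ s, F s ∂(compoundPoisson r m)) := by
  have := hasSum_integral_measure hF
  simp only [integral_smul_measure, ENNReal.toReal_ofReal (poissonWeight_nonneg r _)] at this
  exact this

theorem ae_abs_le_convPow {m : Measure ℝ} [SFinite m] {A : ℝ} (hA : ∀ᵐ y ∂m, |y| ≤ A) (n : ℕ) :
    ∀ᵐ s ∂(convPow m n), |s| ≤ n * A := by
  induction n with
  | zero =>
    rw [convPow, ae_dirac_iff (measurableSet_le (by fun_prop) (by fun_prop))]
    simp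
  | succ n ih =>
    rw [convPow, Measure.conv, ae_map_iff (by fun_prop)
      (measurableSet_le (by fun_prop) (by fun_prop))]
    filter_upwards [Measure.quasiMeasurePreserving_fst.ae ih,
      Measure.quasiMeasurePreserving_snd.ae hA] with x h1 h2
    push_cast
    exact (abs_add_le _ _).trans (by linarith)

variable {m : Measure ℝ} [IsProbabilityMeasure m] {r : ℝ≥0}

instance : IsProbabilityMeasure (compoundPoisson r m) where
  measure_univ := by
    rw [compoundPoisson, Measure.sum_apply _ MeasurableSet.univ]
    simp only [Measure.smul_apply, measure_univ, smul_eq_mul, mul_one]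
    rw [← ENNReal.ofReal_tsum_of_nonneg (poissonWeight_nonneg r) (hasSum_poissonWeight r).summable,
      (hasSum_poissonWeight r).tsum_eq, ENNReal.ofReal_one]

theorem charFun_convPow (n : ℕ) (t : ℝ) : charFun (convPow m n) t = charFun m t ^ n := by
  induction n with
  | zero => simp [convPow]
  | succ n ih => rw [convPow, charFun_conv, ih, pow_succ]

/-- Convolution powers become powers of the characteristic function, and the Poisson mixture sums
them as an exponential series. -/
theorem charFun_compoundPoisson (t : ℝ) :
    charFun (compoundPoisson r m) t = Complex.exp (r * (charFun m t - 1)) := by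
  have hi : Integrable (fun x : ℝ => Complex.exp (t * x * Complex.I)) (compoundPoisson r m) := by
    refine (integrable_const (1 : ℝ)).mono' (by fun_prop) (ae_of_all _ fun x => ?_)
    rw [← Complex.ofReal_mul, Complex.norm_exp_ofReal_mul_I]
  have h := hasSum_integral hi
  simp only [← charFun_apply_real, charFun_convPow] at h
  refine h.unique ?_
  have h2 := (NormedSpace.expSeries_div_hasSum_exp (r * charFun m t)).mul_left
    (Complex.exp (-r))
  rw [← Complex.exp_eq_exp_ℂ, ← Complex.exp_add] at h2
  rw [show (r : ℂ) * (charFun m t - 1) = -r + r * charFun m t by ring]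
  refine h2.congr_fun fun n => ?_
  rw [Complex.real_smul, poissonWeight]
  push_cast
  rw [mul_pow]
  ring

variable {A : ℝ}

theorem integrable_id_convPow (hA : ∀ᵐ y ∂m, |y| ≤ A) (n : ℕ) :
    Integrable (fun s : ℝ => s) (convPow m n) :=
  (integrable_const (n * A)).mono' (by fun_prop) (ae_abs_le_convPow hA n)

theorem integrable_of_ae_abs_le (hA : ∀ᵐ y ∂m, |y| ≤ A) : Integrable (fun y : ℝ => y) m :=
  (integrable_const A).mono' (by fun_prop) hA

theorem integrable_id_compoundPoisson (hA : ∀ᵐ y ∂m, |y| ≤ A) :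
    Integrable (fun s : ℝ => s) (compoundPoisson r m) := by
  refine integrable_sum_measure (fun n => (integrable_id_convPow hA n).smul_measure (by simp)) ?_
  simp only [integral_smul_measure, ENNReal.toReal_ofReal (poissonWeight_nonneg r _), smul_eq_mul]
  refine Summable.of_nonneg_of_le (fun n => mul_nonneg (poissonWeight_nonneg r n)
    (integral_nonneg fun s => norm_nonneg _)) (fun n => ?_)
    ((summable_poissonWeight_mul r).mul_right A)
  rw [mul_assoc]
  refine mul_le_mul_of_nonneg_left ?_ (poissonWeight_nonneg r n)
  have := integral_mono_ae (integrable_id_convPow hA n).norm (integrable_const (n * A))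
    (ae_abs_le_convPow hA n)
  simpa using this

theorem measurable_integral_comp_add {φ : ℝ → ℝ} (hφ : Measurable φ) :
    Measurable fun s => ∫ y, φ (s + y) ∂m :=
  (StronglyMeasurable.integral_prod_right
    (f := fun s y => φ (s + y)) (by
      exact (hφ.comp (measurable_fst.add measurable_snd)).stronglyMeasurable)).measurable

theorem measurable_integral_mul_comp_add {φ : ℝ → ℝ} (hφ : Measurable φ) :
    Measurable fun s => ∫ y, y * φ (s + y) ∂m :=
  (StronglyMeasurable.integral_prod_right
    (f := fun s y => y * φ (s + y)) (by
      exact (measurable_snd.mul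
        (hφ.comp (measurable_fst.add measurable_snd))).stronglyMeasurable)).measurable

theorem abs_integral_mul_comp_add_le (hA : ∀ᵐ y ∂m, |y| ≤ A) {φ : ℝ → ℝ} {C : ℝ}
    (hC : ∀ x, |φ x| ≤ C) (s : ℝ) : |∫ y, y * φ (s + y) ∂m| ≤ A * C := by
  have := norm_integral_le_of_norm_le_const (μ := m) (f := fun y => y * φ (s + y)) (C := A * C) (by
    filter_upwards [hA] with y hy
    rw [norm_mul, Real.norm_eq_abs, Real.norm_eq_abs]
    exact mul_le_mul hy (hC _) (abs_nonneg _) ((abs_nonneg _).trans hy))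
  simpa using this

theorem integrable_mul_of_bounded {μ : Measure ℝ} {φ F : ℝ → ℝ} (hF : Integrable F μ)
    (hφ : Measurable φ) {C : ℝ} (hC : ∀ x, |φ x| ≤ C) : Integrable (fun s => F s * φ s) μ :=
  hF.mul_bdd hφ.aestronglyMeasurable (ae_of_all _ hC)

/-- The exchangeability identity behind the Mecke formula, for a sum of `n + 1` terms. -/
theorem integral_id_mul_convPow_succ (hA : ∀ᵐ y ∂m, |y| ≤ A) (n : ℕ) {φ : ℝ → ℝ}
    (hφ : Measurable φ) {C : ℝ} (hC : ∀ x, |φ x| ≤ C) :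
    ∫ s, s * φ s ∂(convPow m (n + 1))
      = (n + 1) * ∫ s, (∫ y, y * φ (s + y) ∂m) ∂(convPow m n) := by
  induction n generalizing φ with
  | zero => simp [convPow]
  | succ n ih =>
    have hm := integrable_of_ae_abs_le hA
    have hb (s : ℝ) : Integrable (fun y => φ (s + y)) m :=
      (integrable_const C).mono' (hφ.comp (measurable_const_add s)).aestronglyMeasurable
        (ae_of_all _ fun y => hC _)
    have hΦ := measurable_integral_comp_add (m := m) hφ
    have hΦC (s : ℝ) : |∫ y, φ (s + y) ∂m| ≤ C := by
      have := norm_integral_le_of_norm_le_const (μ := m) (f := fun y => φ (s + y))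
        (ae_of_all _ fun y => hC _)
      simpa using this
    have hH := measurable_integral_mul_comp_add (m := m) hφ
    have hHC := abs_integral_mul_comp_add_le hA hC
    have hHi (k : ℕ) : Integrable (fun s => ∫ y, y * φ (s + y) ∂m) (convPow m k) :=
      (integrable_const (A * C)).mono' hH.aestronglyMeasurable (ae_of_all _ hHC)
    -- Split off the last summand. The first term is the induction hypothesis for `φ` averaged over
    -- that summand, hence the induction over all `φ`.
    have h1 : ∫ s, s * φ s ∂(convPow m (n + 1 + 1)) = ∫ s, s * (∫ y, φ (s + y) ∂m)
        ∂(convPow m (n + 1)) + ∫ s, (∫ y, y * φ (s + y) ∂m) ∂(convPow m (n + 1)) := by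
      have hi := integrable_mul_of_bounded (integrable_id_convPow hA (n + 1 + 1)) hφ hC
      rw [convPow, integral_conv (by exact hi), ← integral_add
        (integrable_mul_of_bounded (integrable_id_convPow hA _) hΦ hΦC) (hHi _)]
      congr 1 with s
      rw [← integral_const_mul, ← integral_add ((hb s).const_mul s)
        (by exact integrable_mul_of_bounded hm (hφ.comp (measurable_const_add s)) fun _ => hC _)]
      congr 1 with y
      ring
    -- Fubini exchanges the roles of the last two jumps.
    have h2 : ∫ s, (∫ y, y * φ (s + y) ∂m) ∂(convPow m (n + 1))
        = ∫ s, (∫ y, y * (∫ z, φ (s + y + z) ∂m) ∂m) ∂(convPow m n) := by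
      have hi := hHi (n + 1)
      rw [convPow, integral_conv (by exact hi)]
      congr 1 with s
      simp_rw [← integral_const_mul]
      rw [integral_integral_swap]
      · congr 1 with y
        congr 1 with z
        congr 2
        ring
      · have h3 : Integrable (fun p : ℝ × ℝ => p.2) (m.prod m) := hm.comp_snd m
        refine h3.mul_bdd (c := C) ?_ (ae_of_all _ fun p => hC _)
        exact (hφ.comp (g := φ) (f := fun p : ℝ × ℝ => s + p.1 + p.2)
          (by fun_prop)).aestronglyMeasurable
    rw [h1, ih hΦ hΦC, ← h2]
    push_cast
    ring

/-- The **Mecke formula** for a compound Poisson law. -/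
theorem integral_id_mul (hA : ∀ᵐ y ∂m, |y| ≤ A) {φ : ℝ → ℝ}
    (hφ : Measurable φ) {C : ℝ} (hC : ∀ x, |φ x| ≤ C) :
    ∫ s, s * φ s ∂(compoundPoisson r m)
      = r * ∫ s, (∫ y, y * φ (s + y) ∂m) ∂(compoundPoisson r m) := by
  have hH : Integrable (fun s => ∫ y, y * φ (s + y) ∂m) (compoundPoisson r m) :=
    (integrable_const (A * C)).mono' (measurable_integral_mul_comp_add hφ).aestronglyMeasurable
      (ae_of_all _ (abs_integral_mul_comp_add_le hA hC))
  have h1 := hasSum_integral (r := r)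
    (integrable_mul_of_bounded (integrable_id_compoundPoisson (r := r) hA) hφ hC)
  have h2 := (hasSum_integral hH).mul_left (r : ℝ)
  -- The term without jumps is concentrated at `0` and drops out, so the series can be shifted and
  -- compared termwise by `poissonWeight_succ`.
  rw [← hasSum_nat_add_iff' 1] at h1
  simp only [Finset.range_one, Finset.sum_singleton, convPow, integral_dirac, zero_mul, smul_zero,
    sub_zero] at h1
  refine h1.unique ?_
  refine h2.congr_fun fun n => ?_
  have := integral_id_mul_convPow_succ hA n hφ hC
  rw [convPow] at this
  rw [this, smul_eq_mul, smul_eq_mul, ← mul_assoc, poissonWeight_succ, mul_assoc]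

open CircularNeedlet

/-- **Stein's bound** for a centred compound Poisson law of variance one and bounded jumps. -/
theorem wassersteinDist_le (hA : ∀ᵐ y ∂m, |y| ≤ A) (hv : r * ∫ y, y ^ 2 ∂m = 1) :
    wassersteinDist ((compoundPoisson r m).map fun s => s - r * ∫ y, y ∂m) stdGaussian
      ≤ ENNReal.ofReal (6 * A) := by
  refine iSup₂_le fun g hg => ENNReal.ofReal_le_ofReal ?_
  obtain ⟨f, hfc, hf4, hft⟩ := exists_stein_solution hg
  set c := ∫ x, g x ∂(gaussianReal 0 1)
  set a := ∫ y, y ∂m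
  set Q := compoundPoisson r m
  have hA0 : 0 ≤ A := by
    obtain ⟨y, hy⟩ := hA.exists
    exact (abs_nonneg y).trans hy
  have hid : Integrable (fun s : ℝ => s) Q := integrable_id_compoundPoisson hA
  have hm := integrable_of_ae_abs_le hA
  have hsq : Integrable (fun y : ℝ => y ^ 2) m := by
    refine (integrable_const (A ^ 2)).mono' (by fun_prop) ?_
    filter_upwards [hA] with y hy
    rw [norm_pow]
    exact pow_le_pow_left₀ (norm_nonneg _) hy 2
  let φ : ℝ → ℝ := fun s => f (s - r * a)
  have hφ : Measurable φ := hfc.measurable.comp (by fun_prop)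
  have hφ4 : ∀ s, |φ s| ≤ 4 := fun s => hf4 _
  -- The derivative of `φ`, as prescribed by Stein's equation.
  let φ' : ℝ → ℝ := fun s => (s - r * a) * φ s + (g (s - r * a) - c)
  have hgi : Integrable (fun s => g (s - r * a)) Q := by
    have : LipschitzWith 1 fun s => g (s - r * a) := by
      refine LipschitzWith.of_dist_le_mul fun x y => ?_
      simpa using hg.dist_le_mul (x - r * a) (y - r * a)
    exact this.integrable_of_integrable_id hid
  have hφi : Integrable φ Q := (integrable_const 4).mono' hφ.aestronglyMeasurable (ae_of_all _ hφ4)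
  have hsφ := integrable_mul_of_bounded hid hφ hφ4
  have hwφ : Integrable (fun s => (s - r * a) * φ s) Q :=
    integrable_mul_of_bounded (hid.sub (integrable_const _)) hφ hφ4
  have hφ'i : Integrable φ' Q := hwφ.add (hgi.sub (integrable_const c))
  have hHi : Integrable (fun s => ∫ y, y * φ (s + y) ∂m) Q :=
    (integrable_const (A * 4)).mono' (measurable_integral_mul_comp_add hφ).aestronglyMeasurable
      (ae_of_all _ (abs_integral_mul_comp_add_le hA hφ4))
  have hmecke := integral_id_mul (r := r) hA hφ hφ4
  set v := ∫ y, y ^ 2 ∂m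
  -- Expanding `φ (s + y)` to first order in `y` produces the mean `a` and the second moment `v`;
  -- the remainder is cubic, and one factor `|y|` is bounded by `A`.
  have hrem (s : ℝ) :
      |(∫ y, y * φ (s + y) ∂m) - a * φ s - v * φ' s| ≤ 6 * A * v := by
    have h1 : (∫ y, y * φ (s + y) ∂m) - a * φ s - v * φ' s
        = ∫ y, y * (φ (s + y) - φ s - y * φ' s) ∂m := by
      have e1 : Integrable (fun y => y * φ (s + y)) m :=
        integrable_mul_of_bounded hm (hφ.comp (measurable_const_add s)) fun _ => hφ4 _
      have e2 : Integrable (fun y => y * φ s) m := hm.mul_const _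
      have e3 : Integrable (fun y => y ^ 2 * φ' s) m := hsq.mul_const _
      simp only [a, v]
      rw [← integral_mul_const, ← integral_mul_const, ← integral_sub e1 e2,
        ← integral_sub (by exact e1.sub e2) e3]
      congr 1 with y
      ring
    rw [h1]
    have h2 : ∀ᵐ y ∂m, ‖y * (φ (s + y) - φ s - y * φ' s)‖ ≤ 6 * A * y ^ 2 := by
      filter_upwards [hA] with y hy
      have h3 := hft (s - r * a) y
      rw [show s - r * a + y = s + y - r * a by ring] at h3
      rw [norm_mul, Real.norm_eq_abs, Real.norm_eq_abs]
      calc |y| * |φ (s + y) - φ s - y * φ' s| ≤ A * (6 * y ^ 2) :=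
            mul_le_mul hy h3 (abs_nonneg _) hA0
        _ = _ := by ring
    refine (norm_integral_le_of_norm_le (hsq.const_mul _) h2).trans_eq ?_
    rw [integral_const_mul]
  have hint : ∫ s, ((∫ y, y * φ (s + y) ∂m) - a * φ s - v * φ' s) ∂Q
      = (∫ s, (∫ y, y * φ (s + y) ∂m) ∂Q) - a * ∫ s, φ s ∂Q - v * ∫ s, φ' s ∂Q := by
    rw [integral_sub (by exact hHi.sub (hφi.const_mul a)) (hφ'i.const_mul v),
      integral_sub hHi (hφi.const_mul a), integral_const_mul, integral_const_mul]
  have hg2 : ∫ s, φ' s ∂Q = (∫ s, s * φ s ∂Q) - r * a * (∫ s, φ s ∂Q)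
      + ((∫ s, g (s - r * a) ∂Q) - c) := by
    have e1 : ∫ s, (g (s - r * a) - c) ∂Q = (∫ s, g (s - r * a) ∂Q) - c := by
      rw [integral_sub hgi (integrable_const _)]
      simp
    have e2 : ∫ s, (s - r * a) * φ s ∂Q = (∫ s, s * φ s ∂Q) - r * a * (∫ s, φ s ∂Q) := by
      rw [← integral_const_mul (r * a), ← integral_sub hsφ (hφi.const_mul _)]
      congr 1 with s
      ring
    rw [← e1, ← e2, ← integral_add hwφ (by exact hgi.sub (integrable_const c))]
  -- The Mecke formula replaces the term in `s * φ s`, and `r * v = 1` cancels the integral of `φ'`;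
  -- only the Taylor remainder survives.
  have hfin : (∫ s, g (s - r * a) ∂Q) - c
      = -(r * ∫ s, ((∫ y, y * φ (s + y) ∂m) - a * φ s - v * φ' s) ∂Q) := by
    rw [hint]
    linear_combination -hg2 - hmecke - (∫ s, φ' s ∂Q) * hv
  have hbound := norm_integral_le_of_norm_le_const (μ := Q)
    (f := fun s => (∫ y, y * φ (s + y) ∂m) - a * φ s - v * φ' s) (ae_of_all _ hrem)
  rw [integral_map (by fun_prop) hg.continuous.aestronglyMeasurable, hfin, abs_neg, abs_mul,
    NNReal.abs_eq]
  simp only [Real.norm_eq_abs, probReal_univ, mul_one] at hbound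
  calc _ ≤ (r : ℝ) * (6 * A * v) := by gcongr
    _ = 6 * A * (r * v) := by ring
    _ = _ := by rw [hv, mul_one]

end CompoundPoisson

/-! ### Integrals against Poisson random measures -/

namespace CircularNeedlet

section RandomMeasure

variable {Ω Θ : Type*} [MeasurableSpace Ω] [MeasurableSpace Θ] {P : Measure Ω}
  {μ : Measure Θ} {M : Ω → Measure Θ}

theorem IsPoissonRandomMeasure.measurable (hM : IsPoissonRandomMeasure P μ M) : Measurable M :=
  Measure.measurable_of_measurable_coe _ hM.measurable_apply

theorem IsPoissonRandomMeasure.ae_isFiniteMeasure (hM : IsPoissonRandomMeasure P μ M)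
    [IsFiniteMeasure μ] : ∀ᵐ ω ∂P, IsFiniteMeasure (M ω) := by
  have h1 : ∀ᵐ x ∂(P.map fun ω => M ω Set.univ), x ≠ ∞ := by
    rw [hM.law_of_ne_top _ MeasurableSet.univ (measure_ne_top _ _),
      ae_map_iff Measurable.of_discrete.aemeasurable
        (p := fun x => x ≠ ∞) (measurableSet_singleton _).compl]
    exact ae_of_all _ fun n => ENNReal.natCast_ne_top n
  filter_upwards [ae_of_ae_map (hM.measurable_apply _ MeasurableSet.univ).aemeasurable h1] with ω h
  exact ⟨h.lt_top⟩

theorem IsPoissonRandomMeasure.map_real (hM : IsPoissonRandomMeasure P μ M)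
    [IsFiniteMeasure μ] {A : Set Θ} (hA : MeasurableSet A) :
    P.map (fun ω => (M ω).real A) = (poissonMeasure (μ A).toNNReal).map fun n : ℕ => (n : ℝ) := by
  have h := congrArg (fun Q => Q.map ENNReal.toReal)
    (hM.law_of_ne_top A hA (measure_ne_top _ _))
  rw [Measure.map_map ENNReal.measurable_toReal (hM.measurable_apply A hA),
    Measure.map_map ENNReal.measurable_toReal Measurable.of_discrete] at h
  exact h

/-- The integral is a difference of two lower integrals, measurable in `ω`, whenever `M ω` is
finite. Finiteness holds only almost surely, hence almost everywhere measurability. -/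
theorem IsPoissonRandomMeasure.aemeasurable_integral (hM : IsPoissonRandomMeasure P μ M)
    [IsFiniteMeasure μ] {h : Θ → ℝ} (hh : Measurable h) {C : ℝ} (hC : ∀ θ, |h θ| ≤ C) :
    AEMeasurable (fun ω => ∫ θ, h θ ∂(M ω)) P := by
  have h1 : Measurable fun ω => (∫⁻ θ, ENNReal.ofReal (h θ) ∂(M ω)).toReal
      - (∫⁻ θ, ENNReal.ofReal (-h θ) ∂(M ω)).toReal :=
    ((Measure.measurable_lintegral hh.ennreal_ofReal).comp hM.measurable).ennreal_toReal.sub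
      ((Measure.measurable_lintegral hh.neg.ennreal_ofReal).comp hM.measurable).ennreal_toReal
  refine h1.aemeasurable.congr ?_
  filter_upwards [hM.ae_isFiniteMeasure] with ω hω
  exact (integral_eq_lintegral_pos_part_sub_lintegral_neg_part
    ((integrable_const C).mono' hh.aestronglyMeasurable (ae_of_all _ hC))).symm

/-- The level sets are disjoint, so the integral is a linear combination of independent Poisson
counts and the characteristic function is a product. -/
theorem IsPoissonRandomMeasure.charFun_map_simpleFunc (hM : IsPoissonRandomMeasure P μ M)
    [IsFiniteMeasure μ] (g : SimpleFunc Θ ℝ) (t : ℝ) :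
    charFun (P.map fun ω => ∫ θ, g θ ∂(M ω)) t
      = Complex.exp (∫ θ, (Complex.exp (t * g θ * Complex.I) - 1) ∂μ) := by
  let e := g.range.equivFin
  let A : Fin g.range.card → Set Θ := fun i => g ⁻¹' {(e.symm i : ℝ)}
  have hA (i) : MeasurableSet (A i) := g.measurableSet_preimage _
  have hdisj : Pairwise (Function.onFun Disjoint A) := fun i k hik =>
    Disjoint.preimage _ (Set.disjoint_singleton.2 fun h =>
      hik (e.symm.injective (Subtype.ext h)))
  have hsum {E : Type} [AddCommMonoid E] (F : ℝ → E) :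
      ∑ x ∈ g.range, F x = ∑ i, F (e.symm i) := by
    rw [← Finset.sum_coe_sort, ← e.symm.sum_comp]
  have h1 : P.map (fun ω => ∫ θ, g θ ∂(M ω))
      = P.map (fun ω => ∑ i, (e.symm i : ℝ) * (M ω).real (A i)) := by
    refine Measure.map_congr ?_
    filter_upwards [hM.ae_isFiniteMeasure] with ω hω
    rw [SimpleFunc.integral_eq_sum _ g.integrable_of_isFiniteMeasure, hsum]
    simp only [smul_eq_mul, mul_comm, A]
  have hmeas (i) : Measurable fun ω => (M ω).real (A i) :=
    (hM.measurable_apply _ (hA i)).ennreal_toReal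
  have hind : iIndepFun (fun i ω => (e.symm i : ℝ) * (M ω).real (A i)) P :=
    (hM.independent _ A hA hdisj).comp (fun i x => (e.symm i : ℝ) * x.toReal) fun i => by fun_prop
  have hint : ∫ θ, (Complex.exp (t * g θ * Complex.I) - 1) ∂μ
      = ∑ i, ((μ (A i)).toNNReal : ℂ) * (Complex.exp ((t * e.symm i : ℝ) * Complex.I) - 1) := by
    have h2 := g.integrable_of_isFiniteMeasure (μ := μ)
    let F : ℝ → ℂ := fun x => Complex.exp (t * x * Complex.I) - 1
    have h3 := SimpleFunc.map_integral g F h2 (by simp [F])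
    rw [SimpleFunc.integral_eq_integral _ (SimpleFunc.integrable_of_isFiniteMeasure _), hsum] at h3
    simp only [SimpleFunc.map_apply, F] at h3
    rw [h3]
    refine Finset.sum_congr rfl fun i _ => ?_
    rw [Complex.real_smul, Complex.ofReal_mul]
    rfl
  rw [h1, hind.charFun_map_fun_sum_eq_prod fun i => ((hmeas i).const_mul _).aemeasurable, hint,
    Complex.exp_sum, Finset.prod_apply]
  refine Finset.prod_congr rfl fun i _ => ?_
  rw [charFun_map_mul_comp (hmeas i).aemeasurable, hM.map_real (hA i)]
  have := charFun_map_cast_poissonMeasure (μ (A i)).toNNReal (e.symm i * t)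
  rw [mul_comm t]
  exact this

/-- The characteristic function of the integral of a bounded function against a Poisson random
measure with finite control. -/
theorem IsPoissonRandomMeasure.charFun_map_integral [IsProbabilityMeasure P]
    (hM : IsPoissonRandomMeasure P μ M)
    [IsFiniteMeasure μ] {h : Θ → ℝ} (hh : Measurable h) {C : ℝ} (hC : ∀ θ, |h θ| ≤ C) (t : ℝ) :
    charFun (P.map fun ω => ∫ θ, h θ ∂(M ω)) t
      = Complex.exp (∫ θ, (Complex.exp (t * h θ * Complex.I) - 1) ∂μ) := by
  -- Simple functions bounded by `2C` converge pointwise to `h`; dominated convergence passes to the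
  -- limit on both sides of the simple case.
  let g : ℕ → SimpleFunc Θ ℝ := fun n => SimpleFunc.approxOn h hh Set.univ 0 (Set.mem_univ _) n
  have hg (n θ) : |g n θ| ≤ C + C :=
    (SimpleFunc.norm_approxOn_zero_le hh (Set.mem_univ _) θ n).trans (add_le_add (hC θ) (hC θ))
  have hlim (θ) : Tendsto (fun n => g n θ) atTop (𝓝 (h θ)) :=
    SimpleFunc.tendsto_approxOn hh _ (by simp)
  have hgm (n) : AEMeasurable (fun ω => ∫ θ, g n θ ∂(M ω)) P :=
    hM.aemeasurable_integral (g n).measurable (hg n)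
  have hint : ∀ᵐ ω ∂P, Tendsto (fun n => ∫ θ, g n θ ∂(M ω)) atTop (𝓝 (∫ θ, h θ ∂(M ω))) := by
    filter_upwards [hM.ae_isFiniteMeasure] with ω hω
    exact tendsto_integral_of_dominated_convergence (fun _ => C + C)
      (fun n => (g n).measurable.aestronglyMeasurable) (integrable_const _)
      (fun n => ae_of_all _ (hg n)) (ae_of_all _ hlim)
  have hexp (x : ℝ) : ‖Complex.exp (t * x * Complex.I)‖ ≤ 1 := by
    rw [← Complex.ofReal_mul, Complex.norm_exp_ofReal_mul_I]
  have hL : Tendsto (fun n => charFun (P.map fun ω => ∫ θ, g n θ ∂(M ω)) t) atTop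
      (𝓝 (charFun (P.map fun ω => ∫ θ, h θ ∂(M ω)) t)) := by
    simp only [charFun_apply_real]
    rw [integral_map (hM.aemeasurable_integral hh hC) (by fun_prop)]
    have h1 (n) := integral_map (hgm n) (f := fun x : ℝ => Complex.exp (t * x * Complex.I))
      (by fun_prop)
    simp only [h1]
    refine tendsto_integral_of_dominated_convergence (fun _ => 1) (fun n => ?_)
      (integrable_const _) (fun n => ae_of_all _ fun ω => hexp _) ?_
    · have h2 : Measurable fun x : ℝ => Complex.exp (t * x * Complex.I) := by fun_prop
      exact (h2.comp_aemeasurable (hgm n)).aestronglyMeasurable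
    · filter_upwards [hint] with ω hω
      have h2 : Continuous fun x : ℝ => Complex.exp (t * x * Complex.I) := by fun_prop
      exact (h2.tendsto _).comp hω
  have hR : Tendsto (fun n => Complex.exp (∫ θ, (Complex.exp (t * g n θ * Complex.I) - 1) ∂μ))
      atTop (𝓝 (Complex.exp (∫ θ, (Complex.exp (t * h θ * Complex.I) - 1) ∂μ))) := by
    have h2 : Continuous fun x : ℝ => Complex.exp (t * x * Complex.I) - 1 := by fun_prop
    refine (Complex.continuous_exp.tendsto _).comp
      (tendsto_integral_of_dominated_convergence (fun _ => 1 + 1) (fun n => ?_)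
      (integrable_const _) (fun n => ae_of_all _ fun θ => ?_)
      (ae_of_all _ fun θ => (h2.tendsto _).comp (hlim θ)))
    · exact (h2.measurable.comp (g n).measurable).aestronglyMeasurable
    · exact (norm_sub_le _ _).trans (add_le_add (hexp _) (by simp))
  refine tendsto_nhds_unique hL ?_
  simpa only [hM.charFun_map_simpleFunc] using hR

/-- The integral of a bounded function against a Poisson random measure with control `r • ν` has
a compound Poisson law. -/
theorem IsPoissonRandomMeasure.map_integral [IsProbabilityMeasure P] {ν : Measure Θ}
    [IsProbabilityMeasure ν] {r : ℝ≥0} (hM : IsPoissonRandomMeasure P (r • ν) M)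
    {h : Θ → ℝ} (hh : Measurable h) {C : ℝ} (hC : ∀ θ, |h θ| ≤ C) :
    P.map (fun ω => ∫ θ, h θ ∂(M ω)) = CompoundPoisson.compoundPoisson r (ν.map h) := by
  have := Measure.isProbabilityMeasure_map (μ := ν) hh.aemeasurable
  have := Measure.isProbabilityMeasure_map (hM.aemeasurable_integral hh hC)
  refine Measure.ext_of_charFun (funext fun t => ?_)
  rw [hM.charFun_map_integral hh hC, CompoundPoisson.charFun_compoundPoisson, charFun_apply_real,
    integral_map hh.aemeasurable (by fun_prop), integral_smul_nnreal_measure, integral_sub _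
    (integrable_const _)]
  · simp [NNReal.smul_def]
  · refine (integrable_const (1 : ℝ)).mono' (by fun_prop) (ae_of_all _ fun θ => ?_)
    rw [← Complex.ofReal_mul, Complex.norm_exp_ofReal_mul_I]

end RandomMeasure

/-! ### Sums with an independent Poisson number of terms -/

section RandomSum

variable {Ω Θ : Type*} [MeasurableSpace Ω] [MeasurableSpace Θ] {P : Measure Ω}
  [IsProbabilityMeasure P] {X : ℕ → Ω → Θ} {ν : Measure Θ} {h : Θ → ℝ}

theorem map_sum_range (hX : ∀ i, Measurable (X i)) (hind : iIndepFun X P)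
    (hlaw : ∀ i, P.map (X i) = ν) (hh : Measurable h) (n : ℕ) :
    P.map (fun ω => ∑ i ∈ Finset.range n, h (X i ω)) = CompoundPoisson.convPow (ν.map h) n := by
  have hm (i : ℕ) : Measurable (h ∘ X i) := hh.comp (hX i)
  have hs (n : ℕ) : (fun ω => ∑ i ∈ Finset.range n, h (X i ω))
      = ∑ i ∈ Finset.range n, h ∘ X i := by
    ext ω
    simp
  induction n with
  | zero => simp [CompoundPoisson.convPow]
  | succ n ih =>
    rw [hs] at ih ⊢
    have hi := (hind.comp (fun _ => h) fun _ => hh).indepFun_sum_range_succ hm n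
    have hsm : Measurable (∑ i ∈ Finset.range n, h ∘ X i) := by
      rw [← hs]
      exact Finset.measurable_fun_sum _ fun i _ => hm i
    rw [Finset.sum_range_succ, hi.map_add_eq_map_conv_map hsm (hm n), ih, CompoundPoisson.convPow,
      ← hlaw n, Measure.map_map hh (hX n)]

theorem measurable_sum_range_count {K : Ω → ℕ} (hX : ∀ i, Measurable (X i)) (hK : Measurable K)
    (hh : Measurable h) : Measurable fun ω => ∑ i ∈ Finset.range (K ω), h (X i ω) := by
  have : Measurable fun p : Ω × ℕ => ∑ i ∈ Finset.range p.2, h (X i p.1) :=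
    measurable_from_prod_countable_left fun n =>
      Finset.measurable_fun_sum (Finset.range n) fun i _ => hh.comp (hX i)
  exact this.comp (measurable_id.prodMk hK)

/-- The sum of an independent Poisson number of independent variables has a compound Poisson
law. -/
theorem map_sum_range_count {K : Ω → ℕ} {r : ℝ≥0} (hX : ∀ i, Measurable (X i))
    (hind : iIndepFun X P)
    (hlaw : ∀ i, P.map (X i) = ν) (hK : Measurable K) (hKlaw : P.map K = poissonMeasure r)
    (hKX : IndepFun (fun ω i => X i ω) K P) (hh : Measurable h) :
    P.map (fun ω => ∑ i ∈ Finset.range (K ω), h (X i ω))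
      = CompoundPoisson.compoundPoisson r (ν.map h) := by
  ext A hA
  rw [Measure.map_apply (measurable_sum_range_count hX hK hh) hA,
    CompoundPoisson.compoundPoisson, Measure.sum_apply _ hA]
  have hsum (n : ℕ) : Measurable fun x : ℕ → Θ => ∑ i ∈ Finset.range n, h (x i) :=
    Finset.measurable_fun_sum _ fun i _ => hh.comp (measurable_pi_apply i)
  -- Partition by the value of the count; independence then factors each piece into a Poisson weight
  -- and a convolution power.
  have hdecomp : (fun ω => ∑ i ∈ Finset.range (K ω), h (X i ω)) ⁻¹' A
      = ⋃ n, ((fun ω => ∑ i ∈ Finset.range n, h (X i ω)) ⁻¹' A ∩ K ⁻¹' {n}) := by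
    ext ω
    simp
  rw [hdecomp, measure_iUnion]
  · refine tsum_congr fun n => ?_
    have h1 := (hKX.comp (hsum n) measurable_id).measure_inter_preimage_eq_mul A {n} hA
      (measurableSet_singleton n)
    have h2 := map_sum_range hX hind hlaw hh n
    have hXm : Measurable fun ω i => X i ω := measurable_pi_lambda _ hX
    have h3 : P (K ⁻¹' {n}) = ENNReal.ofReal (CompoundPoisson.poissonWeight r n) := by
      rw [← Measure.map_apply hK (measurableSet_singleton n), hKlaw, poissonMeasure_singleton]
      rfl
    rw [Measure.smul_apply, smul_eq_mul, ← h3, ← h2,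
      Measure.map_apply (by exact (hsum n).comp hXm) hA, mul_comm]
    exact h1
  · intro n k hnk
    refine Disjoint.mono Set.inter_subset_right Set.inter_subset_right ?_
    exact Disjoint.preimage _ (Set.disjoint_singleton.2 hnk)
  · intro n
    exact (((hsum n).comp (measurable_pi_lambda _ hX)) hA).inter
      (hK (measurableSet_singleton n))

end RandomSum

end CircularNeedlet

/-! ### Bounds for Mexican needlets -/

namespace CircularNeedlet

theorem weight_nonneg (s : ℕ) {x : ℝ} (hx : 0 ≤ x) : 0 ≤ weight s x := by
  unfold weight
  positivity

theorem weight_le_factorial (s : ℕ) {x : ℝ} (hx : 0 ≤ x) : weight s x ≤ s.factorial := by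
  have h := Real.pow_div_factorial_le_exp x hx s
  rw [div_le_iff₀ (by positivity)] at h
  rw [weight, Real.exp_neg, ← div_eq_mul_inv, div_le_iff₀ (Real.exp_pos x)]
  linarith

theorem weight_mul_one_add_le (s : ℕ) {x : ℝ} (hx : 0 ≤ x) :
    weight s x * (1 + x) ≤ s.factorial + (s + 1).factorial := by
  have h1 := weight_le_factorial s hx
  have h2 := weight_le_factorial (s + 1) hx
  have h3 : weight (s + 1) x = weight s x * x := by
    unfold weight
    ring
  linarith

/-- A Riemann sum of mesh `b⁻¹` for the integral of `(1 + x)⁻²`, bounded by telescoping: each term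
is at most a difference of consecutive `b * (1 + b⁻¹ * n)⁻¹`. -/
theorem sum_inv_sq_le {b : ℝ} (hb : 0 < b) (N : ℕ) :
    ∑ n ∈ Finset.range N, ((1 + b⁻¹ * (n + 1)) ^ 2)⁻¹ ≤ b := by
  have h : ∑ n ∈ Finset.range N, ((1 + b⁻¹ * (n + 1)) ^ 2)⁻¹ ≤ b * (1 - (1 + b⁻¹ * N)⁻¹) := by
    induction N with
    | zero => simp
    | succ N ih =>
      rw [Finset.sum_range_succ]
      have hp : (0 : ℝ) < 1 + b⁻¹ * N := by positivity
      have hq : (0 : ℝ) < 1 + b⁻¹ * (N + 1) := by positivity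
      have h1 : b * ((1 + b⁻¹ * N)⁻¹ - (1 + b⁻¹ * (N + 1))⁻¹)
          = (1 + b⁻¹ * N)⁻¹ * (1 + b⁻¹ * (N + 1))⁻¹ := by
        field_simp
        ring
      have h2 : ((1 + b⁻¹ * ((N : ℝ) + 1)) ^ 2)⁻¹
          ≤ (1 + b⁻¹ * N)⁻¹ * (1 + b⁻¹ * (N + 1))⁻¹ := by
        rw [sq, mul_inv]
        gcongr
        linarith
      push_cast
      linarith
  refine h.trans ?_
  have : (0 : ℝ) ≤ b * (1 + b⁻¹ * N)⁻¹ := by positivity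
  linarith

theorem weight_sq_le (s : ℕ) {x : ℝ} (hx : 0 ≤ x) :
    weight s (x ^ 2) ≤ 2 * (s.factorial + (s + 1).factorial) * ((1 + x) ^ 2)⁻¹ := by
  rw [← div_eq_mul_inv, le_div_iff₀ (by positivity)]
  have h1 := weight_mul_one_add_le s (sq_nonneg x)
  have h2 := weight_nonneg s (sq_nonneg x)
  nlinarith [mul_nonneg h2 (sq_nonneg (x - 1))]

/-- The weights decay like `(1 + |k| / b)⁻²`, so about `b` frequencies matter. Each half of `ℤ`
contributes at most half of the bound. -/
theorem hasSum_weight {s : ℕ} (hs : 1 ≤ s) {b : ℝ} (hb : 0 < b) :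
    ∃ S ≤ 4 * (s.factorial + (s + 1).factorial) * b,
      HasSum (fun k : ℤ => weight s ((b⁻¹ * (k : ℝ)) ^ 2)) S := by
  set K : ℝ := s.factorial + (s + 1).factorial with hK
  have hK0 : 0 ≤ K := by positivity
  let f : ℕ → ℝ := fun n => weight s ((b⁻¹ * (n + 1)) ^ 2)
  have hf0 (n) : 0 ≤ f n := weight_nonneg s (sq_nonneg _)
  have hfs (N : ℕ) : ∑ n ∈ Finset.range N, f n ≤ 2 * K * b := by
    refine (Finset.sum_le_sum fun n _ => weight_sq_le s (by positivity)).trans ?_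
    rw [← Finset.mul_sum]
    exact mul_le_mul_of_nonneg_left (sum_inv_sq_le hb N) (by positivity)
  have hsum : Summable f := summable_of_sum_range_le hf0 hfs
  have hle : ∑' n, f n ≤ 2 * K * b := Real.tsum_le_of_sum_range_le hf0 hfs
  have h1 : HasSum (fun n : ℕ => weight s ((b⁻¹ * ((n : ℤ) : ℝ)) ^ 2)) (∑' n, f n) := by
    rw [← hasSum_nat_add_iff' 1]
    -- The zero frequency carries no weight because `s ≥ 1`.
    have h0 : weight s 0 = 0 := by
      simp [weight, show s ≠ 0 by omega]
    simpa [h0, f] using hsum.hasSum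
  have h2 : HasSum (fun n : ℕ => weight s ((b⁻¹ * ((-((n : ℤ) + 1) : ℤ) : ℝ)) ^ 2))
      (∑' n, f n) := by
    refine hsum.hasSum.congr_fun fun n => ?_
    simp only [f]
    congr 1
    push_cast
    ring
  exact ⟨_, by linarith, h1.of_nat_of_neg_add_one h2⟩

/-- With `n = ⌈b⌉₊ ≤ 2 * b`, the `n` frequencies `n ≤ k < 2 * n` satisfy `1 ≤ k / b ≤ 4`, so each
weight is at least `exp (-16)`. -/
theorem le_tsum_weight_sq {s : ℕ} {b : ℝ} (hb : 1 ≤ b)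
    (hsum : Summable fun k : ℤ => weight s ((b⁻¹ * (k : ℝ)) ^ 2) ^ 2) :
    b * Real.exp (-16) ^ 2 ≤ ∑' k : ℤ, weight s ((b⁻¹ * (k : ℝ)) ^ 2) ^ 2 := by
  have hb0 : 0 < b := by linarith
  set n := ⌈b⌉₊ with hn
  have h1 : b ≤ n := Nat.le_ceil b
  have h2 : (n : ℝ) ≤ 2 * b := by
    have := Nat.ceil_lt_add_one hb0.le
    linarith
  refine le_trans ?_ (hsum.sum_le_tsum (Finset.Ico (n : ℤ) (2 * n)) fun k _ => sq_nonneg _)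
  have h3 : ∀ k ∈ Finset.Ico (n : ℤ) (2 * n),
      Real.exp (-16) ^ 2 ≤ weight s ((b⁻¹ * (k : ℝ)) ^ 2) ^ 2 := by
    intro k hk
    rw [Finset.mem_Ico] at hk
    have hk1 : (n : ℝ) ≤ k := by exact_mod_cast hk.1
    have hk2 : (k : ℝ) ≤ 2 * n := by exact_mod_cast hk.2.le
    have hx1 : 1 ≤ b⁻¹ * (k : ℝ) := by
      rw [inv_mul_eq_div, le_div_iff₀ hb0]
      linarith
    have hx2 : b⁻¹ * (k : ℝ) ≤ 4 := by
      rw [inv_mul_eq_div, div_le_iff₀ hb0]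
      linarith
    refine pow_le_pow_left₀ (Real.exp_pos _).le ?_ 2
    calc Real.exp (-16) ≤ 1 * Real.exp (-(b⁻¹ * (k : ℝ)) ^ 2) := by
          rw [one_mul]
          gcongr
          nlinarith
      _ ≤ _ := by
          unfold weight
          gcongr
          exact one_le_pow₀ (one_le_pow₀ hx1)
  have h4 := Finset.card_nsmul_le_sum _ _ _ h3
  rw [Int.card_Ico, nsmul_eq_mul, show (2 * (n : ℤ) - n).toNat = n by omega] at h4
  refine le_trans ?_ h4
  gcongr

/-- **Parseval's identity** for an absolutely convergent Fourier series on the circle. -/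
theorem exists_continuousMap_fourier {c : ℤ → ℂ} (hc : Summable fun k => ‖c k‖) :
    ∃ f : C(S1, ℂ), (∀ θ, f θ = ∑' k, c k * fourier k θ) ∧ (∀ θ, ‖f θ‖ ≤ ∑' k, ‖c k‖) ∧
      ∫ θ, ‖f θ‖ ^ 2 ∂rho = ∑' k, ‖c k‖ ^ 2 := by
  have hn (k : ℤ) : ‖c k • (fourier k : C(S1, ℂ))‖ = ‖c k‖ := by
    rw [norm_smul, fourier_norm, mul_one]
  have hsum : Summable fun k => c k • (fourier k : C(S1, ℂ)) :=
    Summable.of_norm (by simpa only [hn] using hc)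
  refine ⟨∑' k, c k • (fourier k : C(S1, ℂ)), fun θ => ?_, fun θ => ?_, ?_⟩
  · rw [← ContinuousMap.tsum_apply hsum]
    rfl
  · refine (ContinuousMap.norm_coe_le_norm _ θ).trans ?_
    refine (norm_tsum_le_tsum_norm (by simpa only [hn] using hc)).trans_eq ?_
    simp only [hn]
  · set f := ∑' k, c k • (fourier k : C(S1, ℂ)) with hf
    let L := ContinuousMap.toLp (E := ℂ) 2 AddCircle.haarAddCircle ℂ (α := S1)
    -- The series also converges in `L²`; pairing it with an orthonormal basis vector isolates one
    -- coefficient.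
    have hcoef (n : ℤ) : fourierCoeff f n = c n := by
      have h1 : HasSum (fun k => c k • fourierLp (T := 2 * Real.pi) 2 k) (L f) := by
        have := hsum.hasSum.mapL L
        simpa only [map_smul] using this
      have h2 := h1.mapL (innerSL ℂ (fourierLp (T := 2 * Real.pi) 2 n))
      have h3 : ∀ k, innerSL ℂ (fourierLp (T := 2 * Real.pi) 2 n)
          (c k • fourierLp (T := 2 * Real.pi) 2 k) = if k = n then c n else 0 := by
        intro k
        rw [map_smul, innerSL_apply_apply, (orthonormal_iff_ite.1 orthonormal_fourier)]
        split_ifs with h4 h5 h5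
        · simp [h4]
        · exact absurd h4.symm h5
        · exact absurd h5.symm h4
        · simp
      simp only [h3] at h2
      have h4 := h2.unique (hasSum_ite_eq n (c n))
      rw [← fourierCoeff_toLp, ← fourierBasis_repr, HilbertBasis.repr_apply_apply,
        coe_fourierBasis]
      exact h4
    have h := tsum_sq_fourierCoeff (L f)
    have h5 : ∫ θ, ‖(L f) θ‖ ^ 2 ∂AddCircle.haarAddCircle = ∫ θ, ‖f θ‖ ^ 2 ∂rho := by
      refine integral_congr_ae ?_
      filter_upwards [ContinuousMap.coeFn_toLp (𝕜 := ℂ) (p := 2) AddCircle.haarAddCircle f] with θ hθ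
      simp only [L]
      rw [hθ]
    rw [← h5, ← h]
    refine tsum_congr fun k => ?_
    rw [fourierCoeff_toLp, hcoef]

instance : IsProbabilityMeasure rho := by
  unfold rho
  infer_instance

variable {B η c₁ c₂ : ℝ}

/-- The basic estimates for a needlet at a fixed resolution: it is continuous, uniformly bounded by
a multiple of `√λ Bʲ`, and its energy is at least a multiple of `λ Bʲ`. -/
theorem needlet_bounds {s : ℕ} (hs : 1 ≤ s) (hB : 1 < B) (D : Pixelization B η c₁ c₂)
    (j : ℕ) (q : Fin (D.Q j)) :
    Continuous (needlet D s j q) ∧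
      (∀ θ, |needlet D s j q θ| ≤ √(rho.real (D.E j q)) *
        (4 * (s.factorial + (s + 1).factorial) * B ^ j)) ∧
      rho.real (D.E j q) * (B ^ j * Real.exp (-16) ^ 2)
        ≤ ∫ θ, needlet D s j q θ ^ 2 ∂rho := by
  have hb : 1 ≤ B ^ j := one_le_pow₀ hB.le
  obtain ⟨S, hS, hsum⟩ := hasSum_weight hs (b := B ^ j) (by linarith)
  let c : ℤ → ℂ := fun k => (weight s (((B ^ j)⁻¹ * (k : ℝ)) ^ 2) : ℂ) *
      (starRingEnd ℂ) (fourier k (D.x j q))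
  have hcn (k : ℤ) : ‖c k‖ = weight s (((B ^ j)⁻¹ * (k : ℝ)) ^ 2) := by
    simp only [c, norm_mul, Complex.norm_real, RCLike.norm_conj, fourier_apply, Circle.norm_coe,
      mul_one]
    exact Real.norm_of_nonneg (weight_nonneg s (sq_nonneg _))
  obtain ⟨f, hf, hfle, hpars⟩ := exists_continuousMap_fourier (c := c)
    (by simpa only [hcn] using hsum.summable)
  set l := rho.real (D.E j q) with hl
  have hψ (θ) : needletC D s j q θ = (√l : ℂ) * f θ := by
    rw [needletC, hf]
  have habs (θ) : |needlet D s j q θ| = √l * ‖f θ‖ := by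
    rw [← Real.norm_eq_abs, ← Complex.norm_real, ofReal_needlet, hψ, norm_mul, Complex.norm_real,
      Real.norm_of_nonneg (Real.sqrt_nonneg _)]
  refine ⟨?_, fun θ => ?_, ?_⟩
  · have : needlet D s j q = fun θ => ((√l : ℂ) * f θ).re := by
      ext θ
      rw [needlet, hψ]
    rw [this]
    fun_prop
  · rw [habs]
    refine mul_le_mul_of_nonneg_left ((hfle θ).trans ?_) (Real.sqrt_nonneg _)
    simp only [hcn]
    rw [hsum.tsum_eq]
    exact hS
  · have h1 (θ) : needlet D s j q θ ^ 2 = l * ‖f θ‖ ^ 2 := by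
      rw [← sq_abs, habs, mul_pow, Real.sq_sqrt measureReal_nonneg]
    simp only [h1]
    rw [integral_const_mul, hpars]
    refine mul_le_mul_of_nonneg_left ?_ measureReal_nonneg
    simp only [hcn]
    refine le_tsum_weight_sq hb (Summable.of_nonneg_of_le (fun k => sq_nonneg _) (fun k => ?_)
      (hsum.summable.mul_left (s.factorial : ℝ)))
    rw [sq]
    exact mul_le_mul_of_nonneg_right (weight_le_factorial s (sq_nonneg _))
      (weight_nonneg s (sq_nonneg _))

theorem integral_densityLaw {F : S1 → ℝ} (hF : Measurable F) (hF0 : ∀ θ, 0 ≤ F θ) (g : S1 → ℝ) :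
    ∫ θ, g θ ∂(densityLaw F) = ∫ θ, F θ * g θ ∂rho := by
  rw [densityLaw, integral_withDensity_eq_integral_toReal_smul hF.ennreal_ofReal
    (ae_of_all _ fun θ => ENNReal.ofReal_lt_top)]
  simp only [ENNReal.toReal_ofReal (hF0 _), smul_eq_mul]

theorem isProbabilityMeasure_densityLaw {F : S1 → ℝ} (hF0 : ∀ θ, 0 ≤ F θ)
    (hF1 : ∫ θ, F θ ∂rho = 1) : IsProbabilityMeasure (densityLaw F) where
  measure_univ := by
    -- A non-integrable function would have Bochner integral `0`, not `1`.
    have hi : Integrable F rho := by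
      by_contra h
      rw [integral_undef h] at hF1
      exact zero_ne_one hF1
    rw [densityLaw, withDensity_apply _ MeasurableSet.univ, Measure.restrict_univ,
      ← ofReal_integral_eq_lintegral_ofReal hi (ae_of_all _ hF0), hF1, ENNReal.ofReal_one]

/-- The constant in the comparison of the uniform norm and the energy of a needlet. -/
noncomputable def needletConst (s : ℕ) (M₀ : ℝ) : ℝ :=
  4 * (s.factorial + (s + 1).factorial) * Real.exp 16 / √M₀

theorem needletConst_pos (s : ℕ) {M₀ : ℝ} (hM₀ : 0 < M₀) : 0 < needletConst s M₀ := by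
  unfold needletConst
  positivity

/-- The supremum scales as `√λ Bʲ` and `σ` at least as `√(λ Bʲ)`, so `λ` cancels from the ratio, and
with it the dependence on `η`, `c₁` and `c₂`. The pixel length enters only through its positivity.
-/
theorem sigma_pos_and_abs_needlet_le {s : ℕ} (hs : 1 ≤ s) (hB : 1 < B) (hη : 0 < η) (hc₁ : 0 < c₁)
    (D : Pixelization B η c₁ c₂) {F : S1 → ℝ} (hF : Measurable F) {M₀ Msup : ℝ} (hM₀ : 0 < M₀)
    (hFM : ∀ θ, M₀ ≤ F θ ∧ F θ ≤ Msup) {j : ℕ} (hj : 1 ≤ j) (q : Fin (D.Q j)) :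
    0 < sigma (densityLaw F) (needlet D s j q) ∧
      ∀ θ, |needlet D s j q θ|
        ≤ needletConst s M₀ * √(B ^ j) * sigma (densityLaw F) (needlet D s j q) := by
  obtain ⟨hcont, hsup, hen⟩ := needlet_bounds hs hB D j q
  set ψ := needlet D s j q
  set l := rho.real (D.E j q)
  have hb : 0 < B ^ j := by positivity
  have hl : 0 < l := lt_of_lt_of_le (by positivity) (D.length_lower j hj q)
  have hF0 (θ) : 0 ≤ F θ := hM₀.le.trans (hFM θ).1
  have hM : M₀ * (l * (B ^ j * Real.exp (-16) ^ 2)) ≤ ∫ θ, ψ θ ^ 2 ∂(densityLaw F) := by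
    rw [integral_densityLaw hF hF0]
    refine (mul_le_mul_of_nonneg_left hen hM₀.le).trans ?_
    rw [← integral_const_mul]
    set A := √l * (4 * (s.factorial + (s + 1).factorial) * B ^ j)
    have hψ2 (θ) : ‖ψ θ ^ 2‖ ≤ A ^ 2 := by
      rw [norm_pow]
      exact pow_le_pow_left₀ (norm_nonneg _) (hsup θ) 2
    have hm : Measurable fun θ => ψ θ ^ 2 := hcont.measurable.pow_const 2
    have hi : Integrable (fun θ => ψ θ ^ 2) rho :=
      (integrable_const (A ^ 2)).mono' hm.aestronglyMeasurable (ae_of_all _ hψ2)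
    refine integral_mono (hi.const_mul _) (hi.bdd_mul (c := Msup) hF.aestronglyMeasurable
      (ae_of_all _ fun θ => ?_)) fun θ => mul_le_mul_of_nonneg_right (hFM θ).1 (sq_nonneg _)
    rw [Real.norm_of_nonneg (hF0 θ)]
    exact (hFM θ).2
  have hσ : √M₀ * √l * √(B ^ j) * Real.exp (-16) ≤ sigma (densityLaw F) ψ := by
    refine Real.le_sqrt_of_sq_le (le_trans (le_of_eq ?_) hM)
    rw [mul_pow, mul_pow, mul_pow, Real.sq_sqrt hM₀.le, Real.sq_sqrt hl.le, Real.sq_sqrt hb.le]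
    ring
  refine ⟨lt_of_lt_of_le (by positivity) hσ, fun θ => (hsup θ).trans ?_⟩
  have h1 : √l * (4 * (s.factorial + (s + 1).factorial) * B ^ j)
      = needletConst s M₀ * √(B ^ j) * (√M₀ * √l * √(B ^ j) * Real.exp (-16)) := by
    have h2 : Real.exp 16 * Real.exp (-16) = 1 := by
      rw [← Real.exp_add]
      simp
    have h3 : √M₀ ≠ 0 := by positivity
    have h4 := Real.mul_self_sqrt hb.le
    calc √l * (4 * (s.factorial + (s + 1).factorial) * B ^ j)
        = √l * (4 * (s.factorial + (s + 1).factorial) * (√(B ^ j) * √(B ^ j)))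
          * (Real.exp 16 * Real.exp (-16)) := by rw [h2, h4, mul_one]
      _ = _ := by
        unfold needletConst
        field_simp
  rw [h1]
  exact mul_le_mul_of_nonneg_left hσ
    (mul_nonneg (needletConst_pos s hM₀).le (Real.sqrt_nonneg _))

end CircularNeedlet

/-! ### Needlet coefficients of the circular Poisson field -/

namespace CircularNeedlet

open CompoundPoisson

theorem circularField_apply {Ω : Type*} (N : Ω → Measure (ℝ≥0 × S1)) (t : ℝ≥0) (ω : Ω) {A : Set S1}
    (hA : MeasurableSet A) : circularField N t ω A = N ω (Set.Icc 0 t ×ˢ A) := by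
  rw [circularField, Measure.map_apply measurable_snd hA,
    Measure.restrict_apply (measurable_snd hA)]
  congr 1
  ext x
  simp [and_comm]

theorem ae_abs_le_map {ν : Measure S1} {A : ℝ} {h : S1 → ℝ} (hh : Measurable h) (hA : ∀ θ, |h θ| ≤ A) :
    ∀ᵐ y ∂(ν.map h), |y| ≤ A := by
  rw [ae_map_iff hh.aemeasurable (measurableSet_le (by fun_prop) (by fun_prop))]
  exact ae_of_all _ hA

variable {Ω : Type*} [MeasurableSpace Ω] {P : Measure Ω}
  {τ : Measure ℝ≥0} {ν : Measure S1} [IsProbabilityMeasure ν] {N : Ω → Measure (ℝ≥0 × S1)}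
  {X : ℕ → Ω → S1} {f : S1 → ℝ} {A : ℝ}

/-- The circular Poisson field `N_t` is a Poisson random measure with control `R_t ν`. -/
theorem isPoissonRandomMeasure_circularField (hτ : IsTimeControl τ)
    (hN : IsPoissonRandomMeasure P (τ.prod ν) N) (t : ℝ≥0) :
    IsPoissonRandomMeasure P ((intensity τ t).toNNReal • ν) (circularField N t) := by
  have happ (A : Set S1) (hA : MeasurableSet A) :
      (fun ω => circularField N t ω A) = fun ω => N ω (Set.Icc 0 t ×ˢ A) :=
    funext fun ω => circularField_apply N t ω hA
  have hprod (A : Set S1) :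
      ((intensity τ t).toNNReal • ν) A = (τ.prod ν) (Set.Icc 0 t ×ˢ A) := by
    rw [Measure.prod_prod, Measure.smul_apply, ENNReal.smul_def, smul_eq_mul]
    congr 1
    exact ENNReal.ofReal_toReal (hτ.finite t)
  have hm (A : Set S1) (hA : MeasurableSet A) : MeasurableSet (Set.Icc 0 t ×ˢ A) :=
    measurableSet_Icc.prod hA
  refine ⟨fun A hA => ?_, fun ω A hA => ?_, fun A hA htop => ?_, fun A hA htop => ?_,
    fun n A hA hd => ?_⟩
  · rw [happ A hA]
    exact hN.measurable_apply _ (hm A hA)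
  · rw [circularField_apply N t ω hA]
    exact hN.integer_valued ω _ (hm A hA)
  · rw [happ A hA, hprod]
    exact hN.law_of_ne_top _ (hm A hA) (hprod A ▸ htop)
  · exact absurd htop (measure_ne_top _ _)
  · have : (fun i ω => circularField N t ω (A i)) = fun i ω => N ω (Set.Icc 0 t ×ˢ A i) :=
      funext fun i => happ (A i) (hA i)
    rw [this]
    exact hN.independent n _ (fun i => hm _ (hA i)) fun i k hik =>
      Set.Disjoint.set_prod_right (hd hik) _ _

theorem measurable_count (hτ : IsTimeControl τ)
    (hN : IsPoissonRandomMeasure P (τ.prod ν) N) (t : ℝ≥0) : Measurable (count N t) :=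
  Nat.measurable_floor.comp ((isPoissonRandomMeasure_circularField hτ hN t).measurable_apply _
    MeasurableSet.univ).ennreal_toReal

/-- The total mass is a Poisson variable cast to the reals, and the floor undoes the cast. -/
theorem map_count (hτ : IsTimeControl τ)
    (hN : IsPoissonRandomMeasure P (τ.prod ν) N) (t : ℝ≥0) :
    P.map (count N t) = poissonMeasure (intensity τ t).toNNReal := by
  have hM := isPoissonRandomMeasure_circularField hτ hN t
  have h := congrArg (fun Q : Measure ℝ => Q.map fun x : ℝ => ⌊x⌋₊) (hM.map_real MeasurableSet.univ)
  rw [Measure.map_map (f := fun ω => (circularField N t ω).real Set.univ) Nat.measurable_floor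
    (hM.measurable_apply _ MeasurableSet.univ).ennreal_toReal,
    Measure.map_map Nat.measurable_floor Measurable.of_discrete] at h
  have h2 : (fun x : ℝ => ⌊x⌋₊) ∘ (fun n : ℕ => (n : ℝ)) = id := by
    ext n
    simp
  rw [h2, Measure.map_id, Measure.smul_apply, ENNReal.smul_def, smul_eq_mul, measure_univ, mul_one,
    ENNReal.toNNReal_coe] at h
  exact h

theorem measurable_sampleCoeff (hτ : IsTimeControl τ)
    (hN : IsPoissonRandomMeasure P (τ.prod ν) N) (hX : ∀ i, Measurable (X i)) (hf : Measurable f)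
    (t : ℝ≥0) : Measurable (sampleCoeff N X τ ν f t) :=
  ((measurable_sum_range_count hX (measurable_count hτ hN t) hf).sub_const _).div_const _

theorem aemeasurable_fieldCoeff (hτ : IsTimeControl τ)
    (hN : IsPoissonRandomMeasure P (τ.prod ν) N) (hf : Measurable f) (hA : ∀ θ, |f θ| ≤ A)
    (t : ℝ≥0) : AEMeasurable (fieldCoeff N τ ν f t) P := by
  refine ((isPoissonRandomMeasure_circularField hτ hN t).aemeasurable_integral
    (hf.div_const _) (C := A / |√(intensity τ t) * sigma ν f|) fun θ => ?_).sub_const _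
  rw [abs_div]
  exact div_le_div_of_nonneg_right (hA θ) (abs_nonneg _)

variable [IsProbabilityMeasure P]

/-- The common law of the normalized coefficients. -/
noncomputable def coeffLaw (τ : Measure ℝ≥0) (ν : Measure S1) (f : S1 → ℝ) (t : ℝ≥0) :
    Measure ℝ :=
  (compoundPoisson (intensity τ t).toNNReal
    (ν.map fun θ => f θ / (√(intensity τ t) * sigma ν f))).map fun s =>
      s - (intensity τ t).toNNReal *
        ∫ y, y ∂(ν.map fun θ => f θ / (√(intensity τ t) * sigma ν f))

theorem intensity_nonneg (τ : Measure ℝ≥0) (t : ℝ≥0) : 0 ≤ intensity τ t := measureReal_nonneg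

theorem intensity_pos (hτ : IsTimeControl τ) {t : ℝ≥0} (ht : 0 < t) : 0 < intensity τ t :=
  (intensity_nonneg τ 0).trans_lt (hτ.strictMono ht)

theorem map_sampleCoeff (hτ : IsTimeControl τ)
    (hN : IsPoissonRandomMeasure P (τ.prod ν) N) (hX : ∀ i, Measurable (X i))
    (hind : iIndepFun X P) (hlaw : ∀ i, P.map (X i) = ν)
    (hXN : ∀ t, IndepFun (fun ω i => X i ω) (fun ω => circularField N t ω Set.univ) P)
    (hf : Measurable f) (t : ℝ≥0) :
    P.map (sampleCoeff N X τ ν f t) = coeffLaw τ ν f t := by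
  set d := √(intensity τ t) * sigma ν f with hd
  have hh : Measurable fun θ => f θ / d := hf.div_const d
  have hK := measurable_count hτ hN t
  have hKX : IndepFun (fun ω i => X i ω) (count N t) P :=
    (hXN t).comp (φ := id) (ψ := fun x : ℝ≥0∞ => ⌊x.toReal⌋₊) measurable_id
      (Nat.measurable_floor.comp ENNReal.measurable_toReal)
  have hsum := map_sum_range_count hX hind hlaw hK (map_count hτ hN t) hKX hh
  rw [coeffLaw, ← hd, ← hsum, Measure.map_map (by fun_prop)
    (measurable_sum_range_count hX hK hh)]
  congr 1
  ext ω
  rw [integral_map hh.aemeasurable (by fun_prop), integral_div, Function.comp_apply,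
    Real.coe_toNNReal _ (intensity_nonneg τ t), ← Finset.sum_div, sampleCoeff, sub_div, ← hd,
    mul_div_assoc]
  rfl

theorem map_fieldCoeff (hτ : IsTimeControl τ)
    (hN : IsPoissonRandomMeasure P (τ.prod ν) N) (hf : Measurable f) (hA : ∀ θ, |f θ| ≤ A)
    (t : ℝ≥0) : P.map (fieldCoeff N τ ν f t) = coeffLaw τ ν f t := by
  set d := √(intensity τ t) * sigma ν f with hd
  have hh : Measurable fun θ => f θ / d := hf.div_const d
  have hC (θ) : |f θ / d| ≤ A / |d| := by
    rw [abs_div]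
    exact div_le_div_of_nonneg_right (hA θ) (abs_nonneg _)
  have hM := isPoissonRandomMeasure_circularField hτ hN t
  rw [coeffLaw, ← hd, ← hM.map_integral hh hC,
    AEMeasurable.map_map_of_aemeasurable (by fun_prop) (hM.aemeasurable_integral hh hC)]
  congr 1
  ext ω
  rw [integral_map hh.aemeasurable (by fun_prop), Function.comp_apply, fieldCoeff,
    compensatedIntegral, integral_smul_measure, ENNReal.toReal_ofReal (intensity_nonneg τ t),
    Real.coe_toNNReal _ (intensity_nonneg τ t), smul_eq_mul]

theorem integrable_id_coeffLaw (hf : Measurable f) (hA : ∀ θ, |f θ| ≤ A) (t : ℝ≥0) :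
    Integrable (fun x : ℝ => x) (coeffLaw τ ν f t) := by
  set d := √(intensity τ t) * sigma ν f with hd
  have hh : Measurable fun θ => f θ / d := hf.div_const d
  have hC (θ) : |f θ / d| ≤ A / |d| := by
    rw [abs_div]
    exact div_le_div_of_nonneg_right (hA θ) (abs_nonneg _)
  have := Measure.isProbabilityMeasure_map (μ := ν) hh.aemeasurable
  rw [coeffLaw, ← hd, integrable_map_measure (by fun_prop) (by fun_prop)]
  exact (integrable_id_compoundPoisson (ae_abs_le_map hh hC)).sub (integrable_const _)

/-- The Gaussian approximation of the normalized coefficients of a bounded function. -/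
theorem wassersteinDist_coeffLaw_le (hf : Measurable f) {t : ℝ≥0} (ht : 0 < intensity τ t)
    (hσ : 0 < sigma ν f) {K : ℝ} (hK : ∀ θ, |f θ| ≤ K * sigma ν f) :
    wassersteinDist (coeffLaw τ ν f t) stdGaussian
      ≤ ENNReal.ofReal (6 * (K / √(intensity τ t))) := by
  set R := intensity τ t with hR
  set σ := sigma ν f with hσ'
  have hd : 0 < √R * σ := mul_pos (Real.sqrt_pos.2 ht) hσ
  have hh : Measurable fun θ => f θ / (√R * σ) := hf.div_const _
  have hC (θ) : |f θ / (√R * σ)| ≤ K / √R := by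
    rw [abs_div, abs_of_pos hd, div_le_iff₀ hd]
    refine (hK θ).trans_eq ?_
    have : √R ≠ 0 := (Real.sqrt_pos.2 ht).ne'
    field_simp
  have := Measure.isProbabilityMeasure_map (μ := ν) hh.aemeasurable
  -- The jumps are bounded by `K / √R`; the remaining goal is unit variance, which holds because `σ
  -- ^ 2` is the uncentred second moment.
  refine wassersteinDist_le (ae_abs_le_map hh hC) ?_
  rw [integral_map hh.aemeasurable (by fun_prop), Real.coe_toNNReal _ ht.le]
  simp only [div_pow]
  have h2 : σ ^ 2 = ∫ θ, f θ ^ 2 ∂ν :=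
    Real.sq_sqrt (integral_nonneg fun θ => sq_nonneg _)
  rw [integral_div, ← h2, mul_pow, Real.sq_sqrt ht.le]
  field_simp

/-- Convergence in the Wasserstein distance implies convergence in distribution. -/
theorem tendstoInDistribution_of_wassersteinDist {ι : Type*} {l : Filter ι}
    [l.IsCountablyGenerated] {Y : ι → Ω → ℝ} (hY : ∀ i, AEMeasurable (Y i) P) {e : ι → ℝ}
    (he : Tendsto e l (𝓝 0))
    (hle : ∀ᶠ i in l, wassersteinDist (P.map (Y i)) stdGaussian ≤ ENNReal.ofReal (e i)) :
    TendstoInDistribution Y l (id : ℝ → ℝ) (fun _ => P) stdGaussian where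
  forall_aemeasurable := hY
  aemeasurable_limit := aemeasurable_id
  tendsto := by
    refine tendsto_iff_forall_lipschitz_integral_tendsto.2 ?_
    rintro g - ⟨L, hL⟩
    simp only [ProbabilityMeasure.coe_mk, Measure.map_id]
    -- Rescaling by `L + 1` instead of `L` avoids dividing by zero for constant test functions.
    have hK : (0 : ℝ) < L + 1 := by positivity
    have hg : LipschitzWith 1 fun x => (L + 1 : ℝ)⁻¹ * g x := by
      refine LipschitzWith.of_dist_le_mul fun x y => ?_
      have := hL.dist_le_mul x y
      rw [Real.dist_eq] at this ⊢
      rw [← mul_sub, abs_mul, abs_of_pos (inv_pos.2 hK), inv_mul_le_iff₀ hK]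
      refine this.trans ?_
      rw [NNReal.coe_one, one_mul]
      gcongr
      linarith
    -- `ENNReal.ofReal` truncates negative values, hence the maximum with `0`.
    have hmax : Tendsto (fun i => (L + 1 : ℝ) * max (e i) 0) l (𝓝 0) := by
      simpa using (he.max (tendsto_const_nhds (x := (0 : ℝ)))).const_mul (L + 1 : ℝ)
    rw [tendsto_iff_dist_tendsto_zero]
    refine squeeze_zero' (Eventually.of_forall fun i => dist_nonneg) ?_ hmax
    filter_upwards [hle] with i hi
    have h1 := (le_iSup₂ (f := fun (g : ℝ → ℝ) (_ : LipschitzWith 1 g) =>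
      ENNReal.ofReal |∫ x, g x ∂(P.map (Y i)) - ∫ x, g x ∂stdGaussian|) _ hg).trans hi
    rw [integral_const_mul, integral_const_mul, ← mul_sub, abs_mul, abs_of_pos (inv_pos.2 hK)] at h1
    have h2 := (ENNReal.ofReal_le_ofReal_iff (le_max_right _ _)).1
      (h1.trans (ENNReal.ofReal_le_ofReal (le_max_left (e i) 0)))
    rwa [inv_mul_le_iff₀ hK] at h2

end CircularNeedlet

/-- At `R = 0` both sides are `0` by convention, so the rewriting is available at `t = 0` as well.
-/
theorem rpow_neg_half_eq {b R : ℝ} (hb : 0 < b) (hR : 0 ≤ R) :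
    (b⁻¹ * R) ^ (-(1 / 2) : ℝ) = √b / √R := by
  rw [Real.rpow_neg (by positivity), ← Real.sqrt_eq_rpow, Real.sqrt_mul (by positivity),
    Real.sqrt_inv, mul_inv, inv_inv, div_eq_mul_inv]

/-! ### The quantitative bound and the limit theorem -/

open CircularNeedlet in
theorem mainTheorem1 (s : ℕ) (hs : 1 ≤ s) (B : ℝ) (hB : 1 < B)
    (c₁ c₂ M₀ Msup : ℝ) (hc₁ : 0 < c₁) (hc₂ : 0 < c₂) (hM₀ : 0 < M₀) :
    ∃ C₀ : ℝ, 0 < C₀ ∧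
      ∀ (η : ℝ) (_ : 0 < η) (_ : η < 1) (D : Pixelization B η c₁ c₂)
        (F : S1 → ℝ) (_ : Measurable F) (_ : ∀ θ, M₀ ≤ F θ ∧ F θ ≤ Msup)
        (_ : ∫ θ, F θ ∂rho = 1)
        (τ : Measure ℝ≥0) (_ : IsTimeControl τ)
        (Ω : Type*) [MeasurableSpace Ω] (P : Measure Ω) [IsProbabilityMeasure P]
        (N : Ω → Measure (ℝ≥0 × S1))
        (_ : IsPoissonRandomMeasure P (τ.prod (densityLaw F)) N)
        (X : ℕ → Ω → S1) (_ : ∀ i, Measurable (X i)) (_ : iIndepFun X P)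
        (_ : ∀ i, P.map (X i) = densityLaw F)
        (_ : ∀ t, IndepFun (fun ω i => X i ω) (fun ω => circularField N t ω Set.univ) P),
        (∀ (j : ℕ) (_ : 1 ≤ j) (q : Fin (D.Q j)) (t : ℝ≥0) (_ : 0 < t),
          (Integrable (sampleCoeff N X τ (densityLaw F) (needlet D s j q) t) P ∧
            wassersteinDist (P.map (sampleCoeff N X τ (densityLaw F) (needlet D s j q) t))
                stdGaussian ≤
              ENNReal.ofReal (C₀ * ((B ^ j)⁻¹ * intensity τ t) ^ (-(1 / 2) : ℝ))) ∧
          (Integrable (fieldCoeff N τ (densityLaw F) (needlet D s j q) t) P ∧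
            wassersteinDist (P.map (fieldCoeff N τ (densityLaw F) (needlet D s j q) t))
                stdGaussian ≤
              ENNReal.ofReal (C₀ * ((B ^ j)⁻¹ * intensity τ t) ^ (-(1 / 2) : ℝ)))) ∧
        (∀ (j : ℝ≥0 → ℕ) (_ : ∀ t, 1 ≤ j t) (q : (t : ℝ≥0) → Fin (D.Q (j t))),
          (Tendsto (fun t => ((B ^ j t)⁻¹ * intensity τ t) ^ (-(1 / 2) : ℝ)) atTop (𝓝 0) ∨
            (fun t => B ^ j t) =o[atTop] intensity τ) →
          TendstoInDistribution
              (fun t => sampleCoeff N X τ (densityLaw F) (needlet D s (j t) (q t)) t)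
              atTop (id : ℝ → ℝ) (fun _ => P) stdGaussian ∧
            TendstoInDistribution
              (fun t => fieldCoeff N τ (densityLaw F) (needlet D s (j t) (q t)) t)
              atTop (id : ℝ → ℝ) (fun _ => P) stdGaussian) := by

  -- The `6` is Stein's constant; the other factor compares the supremum of a needlet with `σ`.
  refine ⟨6 * needletConst s M₀, mul_pos (by norm_num) (needletConst_pos s hM₀), ?_⟩
  intro η hη _ D F hF hFM hF1 τ hτ Ω _ P _ N hN X hX hind hlaw hXN
  have hF0 (θ) : 0 ≤ F θ := hM₀.le.trans (hFM θ).1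
  have := isProbabilityMeasure_densityLaw hF0 hF1
  have hmeas (j : ℕ) (q : Fin (D.Q j)) : Measurable (needlet D s j q) :=
    (needlet_bounds hs hB D j q).1.measurable
  have hbdd (j : ℕ) (q : Fin (D.Q j)) := (needlet_bounds hs hB D j q).2.1
  have hdist (j : ℕ) (hj : 1 ≤ j) (q : Fin (D.Q j)) (t : ℝ≥0) (ht : 0 < t) :
      wassersteinDist (coeffLaw τ (densityLaw F) (needlet D s j q) t) stdGaussian ≤
        ENNReal.ofReal (6 * needletConst s M₀ *
          ((B ^ j)⁻¹ * intensity τ t) ^ (-(1 / 2) : ℝ)) := by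
    obtain ⟨hσ, hsup⟩ := sigma_pos_and_abs_needlet_le hs hB hη hc₁ D hF hM₀ hFM hj q
    refine (wassersteinDist_coeffLaw_le (hmeas j q) (intensity_pos hτ ht) hσ hsup).trans_eq ?_
    rw [rpow_neg_half_eq (by positivity) (intensity_nonneg τ t)]
    congr 1
    ring
  have hsample (j : ℕ) (q : Fin (D.Q j)) (t : ℝ≥0) :=
    map_sampleCoeff hτ hN hX hind hlaw hXN (hmeas j q) t
  have hfield (j : ℕ) (q : Fin (D.Q j)) (t : ℝ≥0) :=
    map_fieldCoeff hτ hN (hmeas j q) (hbdd j q) t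
  have hsm (j : ℕ) (q : Fin (D.Q j)) (t : ℝ≥0) :=
    (measurable_sampleCoeff hτ hN hX (hmeas j q) t).aemeasurable (μ := P)
  have hfm (j : ℕ) (q : Fin (D.Q j)) (t : ℝ≥0) :=
    aemeasurable_fieldCoeff hτ hN (hmeas j q) (hbdd j q) t
  have hint {j : ℕ} {q : Fin (D.Q j)} {t : ℝ≥0} {Y : Ω → ℝ} (hY : AEMeasurable Y P)
      (hYlaw : P.map Y = coeffLaw τ (densityLaw F) (needlet D s j q) t) : Integrable Y P := by
    have h := integrable_id_coeffLaw (τ := τ) (ν := densityLaw F) (hmeas j q) (hbdd j q) t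
    rw [← hYlaw, integrable_map_measure (by fun_prop) hY] at h
    exact h
  refine ⟨fun j hj q t ht => ⟨⟨hint (hsm j q t) (hsample j q t), ?_⟩,
    ⟨hint (hfm j q t) (hfield j q t), ?_⟩⟩, fun j hj q hlim => ?_⟩
  · rw [hsample]
    exact hdist j hj q t ht
  · rw [hfield]
    exact hdist j hj q t ht
  · have hlim : Tendsto (fun t => ((B ^ j t)⁻¹ * intensity τ t) ^ (-(1 / 2) : ℝ)) atTop (𝓝 0) := by
      -- Either hypothesis yields the power form: under `o` the ratio `Bʲ / R_t` tends to zero, and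
      -- so does its square root.
      refine hlim.elim id fun ho => ?_
      have h1 := (ho.tendsto_div_nhds_zero).sqrt
      rw [Real.sqrt_zero] at h1
      refine h1.congr fun t => ?_
      rw [rpow_neg_half_eq (by positivity) (intensity_nonneg τ t),
        Real.sqrt_div (by positivity)]
    have he := hlim.const_mul (6 * needletConst s M₀)
    rw [mul_zero] at he
    have hev : ∀ᶠ t : ℝ≥0 in atTop,
        wassersteinDist (coeffLaw τ (densityLaw F) (needlet D s (j t) (q t)) t) stdGaussian ≤
          ENNReal.ofReal (6 * needletConst s M₀ *
            ((B ^ j t)⁻¹ * intensity τ t) ^ (-(1 / 2) : ℝ)) := by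
      filter_upwards [eventually_gt_atTop 0] with t ht
      exact hdist (j t) (hj t) (q t) t ht
    exact ⟨tendstoInDistribution_of_wassersteinDist (fun t => hsm _ _ t) he
        (by simpa only [hsample] using hev),
      tendstoInDistribution_of_wassersteinDist (fun t => hfm _ _ t) he
        (by simpa only [hfield] using hev)⟩
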